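/- Let $N\ge 5$ and $2^{**}=\frac{2N}{N-4}$. For an open set $\Omega\subset\mathbb R^N$ let $\mathcal D^{2,2}_0(\Omega)$ be the completion of $C_c^\infty(\Omega)$ (real-valued functions) with respect to the norm $\|\Delta u\|_{L^2(\Omega)}$; write $\|\cdot\|_{\mathcal D}$ for its norm. For a real-valued measurable function $f$ on $\Omega$ put $\alpha_f(s)=|\{x\in\Omega:|f(x)|>s\}|$ for $s>0$, and for $t>0$ put $f^*(t)=\inf\{s>0:\alpha_f(s)<t\}$ and $f^{**}(t)=\frac1t\int_0^t f^*(\tau)\,d\tau$; let $|f|_{(p,q)}=\|t^{\frac1p-\frac1q}f^*(t)\|_{L^q((0,\infty))}$ and $\|f\|_{(p,q)}=\|t^{\frac1p-\frac1q}f^{**}(t)\|_{L^q((0,\infty))}$. The Lorentz space $L^{p,q}(\Omega)$ consists of the (classes of a.e. equal) functions $f$ with $|f|_{(p,q)}<\infty$. Then for every open set $\Omega\subset\mathbb R^N$ there is a continuous embedding $$\mathcal D^{2,2}_0(\Omega)\hookrightarrow L^{2^{**},2}(\Omega).$$ More precisely, there is a constant $C\ge 0$ depending only on $N$ such that, for every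 open $\Omega\subset\mathbb R^N$, there is an injective linear map $J$ from $\mathcal D^{2,2}_0(\Omega)$ to the space of classes of a.e. equal measurable functions on $\Omega$, with $J\varphi=\varphi$ a.e. in $\Omega$ for all $\varphi\in C_c^\infty(\Omega)$, such that for all $u\in\mathcal D^{2,2}_0(\Omega)$ one has $Ju\in L^{2^{**},2}(\Omega)$, $$|Ju|_{(2^{**},2)}\le C\,\|u\|_{\mathcal D}\qquad\text{and}\qquad \|Ju\|_{(2^{**},2)}\le C\,\|u\|_{\mathcal D}.$$ -/

import Mathlib

open MeasureTheory Set TopologicalSpace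
open scoped ENNReal NNReal Distributions Laplacian

noncomputable section

/-! ### Decreasing rearrangements and Lorentz spaces -/

section Lorentz

variable {α : Type*} [MeasurableSpace α]

/-- The distribution function `α_f(s) = μ {x : |f x| > s}`. -/
def distributionFunction (μ : Measure α) (f : α → ℝ) (s : ℝ) : ℝ≥0∞ :=
  μ {x | s < |f x|}

/-- The one-dimensional decreasing rearrangement
`f^*(t) = inf {s > 0 : α_f(s) < t}` for `t > 0` (with `inf ∅ = ∞`), and
`f^*(0) = ess sup |f|`. Its values at negative `t` play no role. -/
def decreasingRearrangement (μ : Measure α) (f : α → ℝ) (t : ℝ) : ℝ≥0∞ :=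
  if 0 < t then
    ⨅ (s : ℝ) (_ : 0 < s ∧ distributionFunction μ f s < ENNReal.ofReal t), ENNReal.ofReal s
  else essSup (fun x => ENNReal.ofReal |f x|) μ

/-- The maximal function `f^{**}(t) = (1 / t) ∫₀ᵗ f^*(τ) dτ`, for `t > 0`. -/
def maximalRearrangement (μ : Measure α) (f : α → ℝ) (t : ℝ) : ℝ≥0∞ :=
  (∫⁻ τ in Ioo (0 : ℝ) t, decreasingRearrangement μ f τ) / ENNReal.ofReal t

/-- The Lorentz quasi-norm `|f|_{(p,q)} = ‖t^{1/p - 1/q} f^*(t)‖_{L^q((0,∞))}`. When `q = ∞`,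
`1 / q.toReal = 0`, as it should be. -/
def lorentzQuasiNorm (p : ℝ) (q : ℝ≥0∞) (μ : Measure α) (f : α → ℝ) : ℝ≥0∞ :=
  eLpNorm
    (fun t : ℝ => ENNReal.ofReal (t ^ (1 / p - 1 / q.toReal)) * decreasingRearrangement μ f t)
    q (volume.restrict (Ioi 0))

/-- The Lorentz norm `‖f‖_{(p,q)} = ‖t^{1/p - 1/q} f^{**}(t)‖_{L^q((0,∞))}`. -/
def lorentzNorm (p : ℝ) (q : ℝ≥0∞) (μ : Measure α) (f : α → ℝ) : ℝ≥0∞ :=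
  eLpNorm
    (fun t : ℝ => ENNReal.ofReal (t ^ (1 / p - 1 / q.toReal)) * maximalRearrangement μ f t)
    q (volume.restrict (Ioi 0))

/-- The Lorentz space `L^{p,q}(μ)`: classes of a.e. equal measurable functions with
`|f|_{(p,q)} < ∞`. -/
def lorentzSpace (p : ℝ) (q : ℝ≥0∞) (μ : Measure α) : Set (α →ₘ[μ] ℝ) :=
  {f | lorentzQuasiNorm p q μ f < ∞}

end Lorentz

/-! ### The Beppo-Levi space -/

section BeppoLevi

/-- `C_c^∞(Ω)` (a copy of the type of test functions, so that it can be given the norm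
`‖Δφ‖_{L²(Ω)}` in place of the test-function topology). -/
def SmoothCompact {N : ℕ} (Ω : Opens (EuclideanSpace ℝ (Fin N))) : Type :=
  𝓓(Ω, ℝ)

variable {N : ℕ} {Ω : Opens (EuclideanSpace ℝ (Fin N))}

instance : AddCommGroup (SmoothCompact Ω) := inferInstanceAs (AddCommGroup 𝓓(Ω, ℝ))

instance : Module ℝ (SmoothCompact Ω) := inferInstanceAs (Module ℝ 𝓓(Ω, ℝ))

/-- The underlying function on `ℝ^N` of an element of `C_c^∞(Ω)`. -/
def SmoothCompact.toFun (φ : SmoothCompact Ω) : EuclideanSpace ℝ (Fin N) → ℝ :=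
  TestFunction.toFun φ

theorem SmoothCompact.contDiff_two (φ : SmoothCompact Ω) : ContDiff ℝ 2 φ.toFun :=
  contDiff_infty.1 (TestFunction.contDiff' φ) 2

theorem SmoothCompact.memLp_laplacian (φ : SmoothCompact Ω) :
    MemLp (Δ φ.toFun) 2 (volume.restrict (Ω : Set (EuclideanSpace ℝ (Fin N)))) := by
  have hcont : Continuous (Δ φ.toFun) := by
    rw [InnerProductSpace.laplacian_eq_iteratedFDeriv_stdOrthonormalBasis]
    have := φ.contDiff_two.continuous_iteratedFDeriv (m := 2) le_rfl
    fun_prop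
  have hsupp : HasCompactSupport (Δ φ.toFun) := by
    rw [InnerProductSpace.laplacian_eq_iteratedFDeriv_stdOrthonormalBasis]
    have h : HasCompactSupport φ.toFun := TestFunction.hasCompactSupport' φ
    refine (h.iteratedFDeriv (𝕜 := ℝ) 2).mono fun x hx => ?_
    rw [Function.mem_support] at hx ⊢
    contrapose! hx
    simp [hx]
  exact (hcont.memLp_of_hasCompactSupport hsupp).restrict _

/-- The linear map `φ ↦ Δφ` from `C_c^∞(Ω)` to `L²(Ω)`. -/
def SmoothCompact.laplacianLp (Ω : Opens (EuclideanSpace ℝ (Fin N))) :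
    SmoothCompact Ω →ₗ[ℝ] Lp ℝ 2 (volume.restrict (Ω : Set (EuclideanSpace ℝ (Fin N)))) where
  toFun φ := φ.memLp_laplacian.toLp _
  map_add' φ ψ := by
    rw [← MemLp.toLp_add]
    refine MemLp.toLp_congr _ _ (Filter.Eventually.of_forall fun x => ?_)
    exact φ.contDiff_two.contDiffAt.laplacian_add ψ.contDiff_two.contDiffAt
  map_smul' c φ := by
    rw [RingHom.id_apply, ← MemLp.toLp_const_smul]
    refine MemLp.toLp_congr _ _ (Filter.Eventually.of_forall fun x => ?_)
    exact InnerProductSpace.laplacian_smul c φ.contDiff_two.contDiffAt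

/-- `C_c^∞(Ω)` is (semi)normed by `φ ↦ ‖Δφ‖_{L²(Ω)}`. -/
instance : SeminormedAddCommGroup (SmoothCompact Ω) :=
  SeminormedAddCommGroup.induced _ _ (SmoothCompact.laplacianLp Ω)

instance : NormedSpace ℝ (SmoothCompact Ω) :=
  NormedSpace.induced ℝ _ _ (SmoothCompact.laplacianLp Ω)

theorem SmoothCompact.norm_eq (φ : SmoothCompact Ω) :
    ‖φ‖ = Real.sqrt (∫ x in (Ω : Set (EuclideanSpace ℝ (Fin N))), |Δ φ.toFun x| ^ 2) := by
  change ‖φ.memLp_laplacian.toLp _‖ = _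
  rw [Lp.norm_toLp, φ.memLp_laplacian.eLpNorm_eq_integral_rpow_norm (by norm_num) (by norm_num),
    ENNReal.toReal_ofReal (by positivity), Real.sqrt_eq_rpow]
  norm_num

/-- The Beppo-Levi space `D^{2,2}_0(Ω)`: the completion of `C_c^∞(Ω)` with respect to
`‖Δφ‖_{L²(Ω)}`. -/
abbrev BeppoLevi (Ω : Opens (EuclideanSpace ℝ (Fin N))) : Type :=
  UniformSpace.Completion (SmoothCompact Ω)

end BeppoLevi

end

/-!
Let `d` be the dimension and `B` the unit ball. Taylor's formula along a ray gives
`|φ(x)| ≤ ∫₀^∞ r |D²φ|(x + r z) dr` for every `z`. Averaging over `z ∈ B` and over the points `x`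
where `|φ|` is large, and estimating averages of `|D²φ|` by its rearrangement, one finds
`φ^*(t) ≤ ∫₀^∞ r (|D²φ|)^{**}(max (t, |B| r^d)) dr`. In the variable `ρ = r (|B| / t)^{1/d}`
the right-hand side becomes a superposition of dilates of `(|D²φ|)^{**}`, so for `d > 4` Minkowski's
inequality bounds `|φ|_{(2d/(d-4), 2)}` by a multiple of the `L²` norm of `(|D²φ|)^{**}`, which
Hardy's inequality bounds by `2 ‖D²φ‖₂`; and `‖D²φ‖₂ ≤ ‖Δφ‖₂` by two integrations by parts.

The bound passes to the completion by Fatou's lemma, elements of the completion being realised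
as functions by means of Sobolev's inequality. The realisation is injective because
`∫ (Δu) ψ = ∫ u Δψ` for test functions `ψ`, so that a vanishing `u` has vanishing Laplacian.
-/

section Rearrangement

variable {α : Type*} [MeasurableSpace α] {μ ν : Measure α} {f : α → ℝ} {s t : ℝ}

theorem distributionFunction_antitone (μ : Measure α) (f : α → ℝ) :
    Antitone (distributionFunction μ f) :=
  fun _ _ h => measure_mono fun _ hx => h.trans_lt hx

theorem decreasingRearrangement_eq_iInf (ht : 0 < t) :
    decreasingRearrangement μ f t =
      ⨅ (s : ℝ) (_ : 0 < s ∧ distributionFunction μ f s < ENNReal.ofReal t), ENNReal.ofReal s :=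
  if_pos ht

theorem le_decreasingRearrangement (ht : 0 < t)
    (h : ENNReal.ofReal t ≤ distributionFunction μ f s) :
    ENNReal.ofReal s ≤ decreasingRearrangement μ f t := by
  rw [decreasingRearrangement_eq_iInf ht]
  refine le_iInf₂ fun r hr => ENNReal.ofReal_le_ofReal ?_
  by_contra! hrs
  exact (hr.2.trans_le h).not_ge (distributionFunction_antitone μ f hrs.le)

theorem le_distributionFunction_of_lt_decreasingRearrangement (ht : 0 < t)
    (h : ENNReal.ofReal s < decreasingRearrangement μ f t) :
    ENNReal.ofReal t ≤ distributionFunction μ f s := by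
  obtain ⟨r, -, hsr, hrt⟩ := ENNReal.lt_iff_exists_real_btwn.1 h
  have hr : 0 < r ∧ s < r := by
    simpa only [ENNReal.ofReal_lt_ofReal_iff', and_comm] using hsr
  by_contra! hlt
  rw [decreasingRearrangement_eq_iInf ht] at hrt
  exact hrt.not_ge <|
    iInf₂_le r ⟨hr.1, (distributionFunction_antitone μ f hr.2.le).trans_lt hlt⟩

theorem decreasingRearrangement_le_essSup (μ : Measure α) (f : α → ℝ) (t : ℝ) :
    decreasingRearrangement μ f t ≤ essSup (fun x => ENNReal.ofReal |f x|) μ := by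
  rcases le_or_gt t 0 with ht | ht
  · exact (if_neg ht.not_gt).le
  by_contra! h
  obtain ⟨s, -, hs, hst⟩ := ENNReal.lt_iff_exists_real_btwn.1 h
  have hnull : distributionFunction μ f s = 0 := by
    refine measure_mono_null (fun x hx => ?_) (ae_iff.1 (ae_lt_of_essSup_lt hs))
    exact (ENNReal.ofReal_le_ofReal (le_of_lt hx)).not_gt
  have := le_distributionFunction_of_lt_decreasingRearrangement ht hst
  simp [hnull, ht.not_ge] at this

theorem decreasingRearrangement_antitone (μ : Measure α) (f : α → ℝ) :
    Antitone (decreasingRearrangement μ f) := by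
  intro t t' h
  rcases le_or_gt t 0 with ht | ht
  · exact (decreasingRearrangement_le_essSup μ f t').trans (if_neg ht.not_gt).ge
  · rw [decreasingRearrangement_eq_iInf ht, decreasingRearrangement_eq_iInf (ht.trans_le h)]
    exact le_iInf₂ fun s hs => iInf₂_le s ⟨hs.1, hs.2.trans_le (ENNReal.ofReal_le_ofReal h)⟩

theorem measurable_decreasingRearrangement (μ : Measure α) (f : α → ℝ) :
    Measurable (decreasingRearrangement μ f) :=
  (decreasingRearrangement_antitone μ f).measurable

theorem decreasingRearrangement_mono_measure (h : ν ≤ μ) (f : α → ℝ) (ht : 0 < t) :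
    decreasingRearrangement ν f t ≤ decreasingRearrangement μ f t := by
  rw [decreasingRearrangement_eq_iInf ht, decreasingRearrangement_eq_iInf ht]
  exact le_iInf₂ fun s hs => iInf₂_le s ⟨hs.1, (h _).trans_lt hs.2⟩

theorem decreasingRearrangement_eq_zero (h : μ univ < ENNReal.ofReal t) :
    decreasingRearrangement μ f t = 0 := by
  have ht : 0 < t := ENNReal.ofReal_pos.1 (pos_of_gt h)
  by_contra! hne
  have := le_distributionFunction_of_lt_decreasingRearrangement (s := 0) ht
    (by simpa using pos_iff_ne_zero.2 hne)
  exact (h.trans_le this).not_ge (measure_mono (subset_univ _))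

theorem volume_restrict_Ioi_setOf_ofReal_lt (m : ℝ≥0∞) :
    volume.restrict (Ioi 0) {t : ℝ | ENNReal.ofReal t < m} = m := by
  rw [Measure.restrict_apply (measurableSet_lt ENNReal.measurable_ofReal measurable_const)]
  rcases eq_or_ne m ∞ with rfl | hm
  · simp
  · have : {t : ℝ | ENNReal.ofReal t < m} ∩ Ioi 0 = Ioo 0 m.toReal := by
      ext t
      simp only [mem_inter_iff, mem_ofPred_eq, mem_Ioi, mem_Ioo, and_comm (a := _ < m),
        and_congr_right_iff]
      exact fun ht => ENNReal.ofReal_lt_iff_lt_toReal ht.le hm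
    rw [this, Real.volume_Ioo, sub_zero, ENNReal.ofReal_toReal hm]

theorem volume_restrict_Ioi_setOf_ofReal_le (m : ℝ≥0∞) :
    volume.restrict (Ioi 0) {t : ℝ | ENNReal.ofReal t ≤ m} = m := by
  refine (le_of_forall_gt_imp_ge_of_dense fun c hc => ?_).antisymm ?_
  · rw [← volume_restrict_Ioi_setOf_ofReal_lt c]
    exact measure_mono (ofPred_subset_ofPred.2 fun t ht => ht.trans_lt hc)
  · conv_lhs => rw [← volume_restrict_Ioi_setOf_ofReal_lt m]
    exact measure_mono (ofPred_subset_ofPred.2 fun t ht => ht.le)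

theorem distributionFunction_eq_iSup (μ : Measure α) (f : α → ℝ) (s : ℝ) :
    distributionFunction μ f s = ⨆ n : ℕ, distributionFunction μ f (s + 1 / (n + 1)) := by
  have hmono : Monotone fun n : ℕ => {x | s + 1 / ((n : ℝ) + 1) < |f x|} := fun m n hmn x hx =>
    lt_of_le_of_lt (by gcongr) (mem_ofPred_eq ▸ hx)
  simp only [distributionFunction]
  rw [← hmono.measure_iUnion]
  congr 1
  ext x
  simp only [mem_ofPred_eq, mem_iUnion]
  refine ⟨fun hx => ?_, fun ⟨n, hn⟩ => lt_trans (lt_add_of_pos_right s Nat.one_div_pos_of_nat) hn⟩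
  obtain ⟨n, hn⟩ := exists_nat_one_div_lt (sub_pos.2 hx)
  exact ⟨n, by linarith⟩

theorem volume_restrict_Ioi_setOf_lt_decreasingRearrangement (μ : Measure α) (f : α → ℝ)
    (hs : 0 ≤ s) :
    volume.restrict (Ioi 0) {t | ENNReal.ofReal s < decreasingRearrangement μ f t} =
      distributionFunction μ f s := by
  refine le_antisymm ?_ ?_
  · rw [← volume_restrict_Ioi_setOf_ofReal_le (distributionFunction μ f s)]
    refine measure_mono_ae <| (ae_restrict_iff' measurableSet_Ioi).2 <| .of_forall fun t ht h => ?_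
    exact le_distributionFunction_of_lt_decreasingRearrangement ht h
  · rw [distributionFunction_eq_iSup]
    refine iSup_le fun n => ?_
    rw [← volume_restrict_Ioi_setOf_ofReal_le (distributionFunction μ f _)]
    refine measure_mono_ae <| (ae_restrict_iff' measurableSet_Ioi).2 <| .of_forall fun t ht h => ?_
    refine lt_of_lt_of_le ?_ (le_decreasingRearrangement ht h)
    exact (ENNReal.ofReal_lt_ofReal_iff_of_nonneg hs).2
      (lt_add_of_pos_right s Nat.one_div_pos_of_nat)

theorem lintegral_eq_lintegral_measure_ofReal_lt [SFinite μ] {g : α → ℝ≥0∞} (hg : Measurable g) :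
    ∫⁻ x, g x ∂μ = ∫⁻ s in Ioi (0 : ℝ), μ {x | ENNReal.ofReal s < g x} := by
  have hmeas : MeasurableSet {z : α × ℝ | ENNReal.ofReal z.2 < g z.1} :=
    measurableSet_lt (by fun_prop) (by fun_prop)
  calc
    ∫⁻ x, g x ∂μ = ∫⁻ x, volume.restrict (Ioi 0) {s : ℝ | ENNReal.ofReal s < g x} ∂μ := by
      simp_rw [volume_restrict_Ioi_setOf_ofReal_lt]
    _ = (μ.prod (volume.restrict (Ioi 0))) {z : α × ℝ | ENNReal.ofReal z.2 < g z.1} :=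
      (Measure.prod_apply hmeas).symm
    _ = _ := Measure.prod_apply_symm hmeas

theorem lintegral_rpow_decreasingRearrangement {p : ℝ} (hp : 0 < p) (hf : AEMeasurable f μ) :
    ∫⁻ t in Ioi (0 : ℝ), decreasingRearrangement μ f t ^ p = ∫⁻ x, ‖f x‖ₑ ^ p ∂μ := by
  have hlayer : ∫⁻ x, ‖f x‖ₑ ^ p ∂μ = ∫⁻ s in Ioi (0 : ℝ), μ {x | s < |f x| ^ p} := by
    rw [← lintegral_eq_lintegral_meas_lt μ (.of_forall fun x => by positivity) (by fun_prop)]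
    refine lintegral_congr fun x => ?_
    rw [Real.enorm_eq_ofReal_abs, ENNReal.ofReal_rpow_of_nonneg (abs_nonneg _) hp.le]
  rw [hlayer, lintegral_eq_lintegral_measure_ofReal_lt
    ((measurable_decreasingRearrangement μ f).pow_const p)]
  refine setLIntegral_congr_fun measurableSet_Ioi fun s hs => ?_
  have hroot : 0 ≤ s ^ p⁻¹ := Real.rpow_nonneg (le_of_lt hs) _
  have h := volume_restrict_Ioi_setOf_lt_decreasingRearrangement μ f hroot
  simpa only [distributionFunction, Real.rpow_inv_lt_iff_of_pos (le_of_lt hs) (abs_nonneg _) hp,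
    ← ENNReal.ofReal_rpow_of_nonneg (le_of_lt hs) (inv_nonneg.2 hp.le),
    ENNReal.rpow_inv_lt_iff hp] using h

theorem setLIntegral_enorm_le_setLIntegral_decreasingRearrangement {A : Set α} (hA : μ A ≠ ∞)
    (hf : AEMeasurable f (μ.restrict A)) :
    ∫⁻ x in A, ‖f x‖ₑ ∂μ ≤ ∫⁻ t in Ioo 0 (μ A).toReal, decreasingRearrangement μ f t := by
  calc
    ∫⁻ x in A, ‖f x‖ₑ ∂μ = ∫⁻ t in Ioi (0 : ℝ), decreasingRearrangement (μ.restrict A) f t := by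
      simpa using (lintegral_rpow_decreasingRearrangement one_pos hf).symm
    _ ≤ ∫⁻ t in Ioi (0 : ℝ),
        (Ioc 0 (μ A).toReal).indicator (decreasingRearrangement μ f) t := by
      refine setLIntegral_mono' measurableSet_Ioi fun t ht => ?_
      rcases le_or_gt t (μ A).toReal with htA | htA
      · rw [indicator_of_mem (mem_Ioc.2 ⟨ht, htA⟩)]
        exact decreasingRearrangement_mono_measure Measure.restrict_le_self f ht
      · rw [decreasingRearrangement_eq_zero]
        · exact zero_le
        · rwa [Measure.restrict_apply_univ, ENNReal.lt_ofReal_iff_toReal_lt hA]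
    _ = ∫⁻ t in Ioo 0 (μ A).toReal, decreasingRearrangement μ f t := by
      rw [setLIntegral_indicator measurableSet_Ioc, inter_eq_left.2 Ioc_subset_Ioi_self,
        setLIntegral_congr Ioo_ae_eq_Ioc]

theorem setLIntegral_enorm_le_mul_maximalRearrangement {A : Set α} (hA : μ A ≠ ∞)
    (hf : AEMeasurable f (μ.restrict A)) :
    ∫⁻ x in A, ‖f x‖ₑ ∂μ ≤ μ A * maximalRearrangement μ f (μ A).toReal := by
  rcases eq_or_ne (μ A) 0 with h0 | h0
  · simp [setLIntegral_measure_zero _ _ h0]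
  · rw [maximalRearrangement, ENNReal.ofReal_toReal hA, ENNReal.mul_div_cancel h0 hA]
    exact setLIntegral_enorm_le_setLIntegral_decreasingRearrangement hA hf

end Rearrangement

section Minkowski

theorem eLpNorm_two_eq_lintegral_sq {α : Type*} [MeasurableSpace α] {μ : Measure α}
    (g : α → ℝ≥0∞) : eLpNorm g 2 μ = (∫⁻ x, g x ^ 2 ∂μ) ^ (1 / 2 : ℝ) := by
  rw [eLpNorm_eq_lintegral_rpow_enorm_toReal (by norm_num) (by norm_num)]
  simp

theorem eLpNorm_two_sq {α : Type*} [MeasurableSpace α] {μ : Measure α} (g : α → ℝ≥0∞) :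
    eLpNorm g 2 μ ^ 2 = ∫⁻ x, g x ^ 2 ∂μ := by
  rw [eLpNorm_two_eq_lintegral_sq, ← ENNReal.rpow_natCast, ← ENNReal.rpow_mul]
  simp

variable {α β : Type*} [MeasurableSpace α] [MeasurableSpace β] {μ : Measure α} {ν : Measure β}

theorem lintegral_mul_le_eLpNorm_two_mul {g h : α → ℝ≥0∞} (hg : AEMeasurable g μ)
    (hh : AEMeasurable h μ) :
    ∫⁻ x, g x * h x ∂μ ≤ eLpNorm g 2 μ * eLpNorm h 2 μ := by
  simpa [eLpNorm_two_eq_lintegral_sq] using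
    ENNReal.lintegral_mul_le_Lp_mul_Lq μ Real.HolderConjugate.two_two hg hh

theorem eLpNorm_two_lintegral_le [SFinite μ] [SFinite ν] {g : α → β → ℝ≥0∞}
    (hg : Measurable (Function.uncurry g)) :
    eLpNorm (fun x => ∫⁻ y, g x y ∂ν) 2 μ ≤ ∫⁻ y, eLpNorm (fun x => g x y) 2 μ ∂ν := by
  have hx y : Measurable fun x => g x y := hg.comp measurable_prodMk_right
  have hy x : Measurable (g x) := hg.comp measurable_prodMk_left
  have hnorm : Measurable fun y => eLpNorm (fun x => g x y) 2 μ := by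
    simp_rw [eLpNorm_two_eq_lintegral_sq]
    exact (hg.pow_const 2).lintegral_prod_left'.pow_const _
  have hprod : Measurable fun w : (α × β) × β => g w.1.1 w.1.2 * g w.1.1 w.2 :=
    (hg.comp measurable_fst).mul
      (hg.comp (by fun_prop : Measurable fun w : (α × β) × β => (w.1.1, w.2)))
  rw [← ENNReal.pow_le_pow_left_iff two_ne_zero, eLpNorm_two_sq]
  calc
    ∫⁻ x, (∫⁻ y, g x y ∂ν) ^ 2 ∂μ = ∫⁻ x, ∫⁻ y, ∫⁻ z, g x y * g x z ∂ν ∂ν ∂μ := by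
      refine lintegral_congr fun x => ?_
      simp_rw [lintegral_const_mul _ (hy x), lintegral_mul_const _ (hy x), sq]
    _ = ∫⁻ y, ∫⁻ x, ∫⁻ z, g x y * g x z ∂ν ∂μ ∂ν :=
      lintegral_lintegral_swap hprod.lintegral_prod_right'.aemeasurable
    _ = ∫⁻ y, ∫⁻ z, ∫⁻ x, g x y * g x z ∂μ ∂ν ∂ν := by
      refine lintegral_congr fun y => lintegral_lintegral_swap ?_
      exact (((hx y).comp measurable_fst).mul hg).aemeasurable
    _ ≤ ∫⁻ y, ∫⁻ z, eLpNorm (fun x => g x y) 2 μ * eLpNorm (fun x => g x z) 2 μ ∂ν ∂ν := by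
      gcongr with y z
      exact lintegral_mul_le_eLpNorm_two_mul (hx y).aemeasurable (hx z).aemeasurable
    _ = (∫⁻ y, eLpNorm (fun x => g x y) 2 μ ∂ν) ^ 2 := by
      simp_rw [lintegral_const_mul _ hnorm, lintegral_mul_const _ hnorm, sq]

end Minkowski

section Dilation

theorem lintegral_Ioc_rpow {p c : ℝ} (hp : -1 < p) (hc : 0 ≤ c) :
    ∫⁻ t in Ioc 0 c, ENNReal.ofReal (t ^ p) = ENNReal.ofReal (c ^ (p + 1) / (p + 1)) := by
  rw [← ofReal_integral_eq_lintegral_ofReal, ← intervalIntegral.integral_of_le hc,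
    integral_rpow (Or.inl hp), Real.zero_rpow (by linarith), sub_zero]
  · exact (intervalIntegrable_iff_integrableOn_Ioc_of_le hc).1
      (intervalIntegral.intervalIntegrable_rpow' hp)
  · exact (ae_restrict_iff' measurableSet_Ioc).2 (.of_forall fun t ht => Real.rpow_nonneg ht.1.le _)

theorem lintegral_comp_mul_left {c : ℝ} (hc : c ≠ 0) (g : ℝ → ℝ≥0∞) :
    ∫⁻ t, g (c * t) = ENNReal.ofReal |c⁻¹| * ∫⁻ t, g t := by
  rw [← (measurableEmbedding_mulLeft₀ hc).lintegral_map, Real.map_volume_mul_left hc,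
    lintegral_smul_measure, smul_eq_mul]

theorem setLIntegral_Ioi_comp_mul_left {c : ℝ} (hc : 0 < c) (g : ℝ → ℝ≥0∞) :
    ∫⁻ t in Ioi 0, g (c * t) = ENNReal.ofReal c⁻¹ * ∫⁻ t in Ioi 0, g t := by
  have h := lintegral_comp_mul_left hc.ne' ((Ioi 0).indicator g)
  rw [abs_of_pos (inv_pos.2 hc), lintegral_indicator measurableSet_Ioi] at h
  rw [← h, ← lintegral_indicator measurableSet_Ioi]
  simp [indicator, hc]

theorem eLpNorm_two_comp_mul_left {c : ℝ} (hc : 0 < c) (g : ℝ → ℝ≥0∞) :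
    eLpNorm (fun t => g (c * t)) 2 (volume.restrict (Ioi 0)) =
      ENNReal.ofReal (c ^ (-1 / 2 : ℝ)) * eLpNorm g 2 (volume.restrict (Ioi 0)) := by
  rw [eLpNorm_two_eq_lintegral_sq, eLpNorm_two_eq_lintegral_sq,
    setLIntegral_Ioi_comp_mul_left hc fun t => g t ^ 2,
    ENNReal.mul_rpow_of_nonneg _ _ (by norm_num),
    ENNReal.ofReal_rpow_of_nonneg (by positivity) (by norm_num), neg_div, Real.rpow_neg hc.le,
    Real.inv_rpow hc.le]

theorem eLpNorm_two_lintegral_mul_comp_mul_le {β : Type*} [MeasurableSpace β] {ν : Measure β}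
    [SFinite ν] {k : β → ℝ≥0∞} {l : β → ℝ} {g : ℝ → ℝ≥0∞} (hk : Measurable k) (hl : Measurable l)
    (hpos : ∀ᵐ y ∂ν, 0 < l y) (hg : Measurable g) :
    eLpNorm (fun t => ∫⁻ y, k y * g (l y * t) ∂ν) 2 (volume.restrict (Ioi 0)) ≤
      (∫⁻ y, k y * ENNReal.ofReal (l y ^ (-1 / 2 : ℝ)) ∂ν) *
        eLpNorm g 2 (volume.restrict (Ioi 0)) := by
  rw [← lintegral_mul_const _ (by fun_prop)]
  refine (eLpNorm_two_lintegral_le (by fun_prop)).trans_eq (lintegral_congr_ae ?_)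
  filter_upwards [hpos] with y hy
  rw [mul_assoc, ← eLpNorm_two_comp_mul_left hy, eLpNorm_two_eq_lintegral_sq,
    eLpNorm_two_eq_lintegral_sq]
  simp_rw [mul_pow]
  rw [lintegral_const_mul _ (by fun_prop), ENNReal.mul_rpow_of_nonneg _ _ (by norm_num)]
  congr 1
  rw [← ENNReal.rpow_natCast, ← ENNReal.rpow_mul]
  simp

end Dilation

section LorentzNorms

variable {α : Type*} [MeasurableSpace α] {μ ν : Measure α} {f : α → ℝ} {t p : ℝ}

theorem maximalRearrangement_eq_setLIntegral_comp_mul (ht : 0 < t) :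
    maximalRearrangement μ f t = ∫⁻ σ in Ioo (0 : ℝ) 1, decreasingRearrangement μ f (σ * t) := by
  have h := lintegral_comp_mul_left ht.ne' ((Ioo 0 t).indicator (decreasingRearrangement μ f))
  rw [abs_of_pos (inv_pos.2 ht), lintegral_indicator measurableSet_Ioo,
    ENNReal.ofReal_inv_of_pos ht,
    ← ENNReal.div_eq_inv_mul] at h
  rw [maximalRearrangement, ← h, ← lintegral_indicator measurableSet_Ioo]
  refine lintegral_congr fun σ => ?_
  simp only [indicator, mem_Ioo, mul_pos_iff_of_pos_left ht, mul_lt_iff_lt_one_right ht,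
    mul_comm σ t]

theorem maximalRearrangement_le_of_le {s : ℝ} (hs : 0 < s) (hst : s ≤ t) :
    maximalRearrangement μ f t ≤ maximalRearrangement μ f s := by
  rw [maximalRearrangement_eq_setLIntegral_comp_mul hs,
    maximalRearrangement_eq_setLIntegral_comp_mul (hs.trans_le hst)]
  exact setLIntegral_mono' measurableSet_Ioo fun σ hσ =>
    decreasingRearrangement_antitone μ f (mul_le_mul_of_nonneg_left hst hσ.1.le)

theorem decreasingRearrangement_le_maximalRearrangement (ht : 0 < t) :
    decreasingRearrangement μ f t ≤ maximalRearrangement μ f t := by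
  rw [maximalRearrangement_eq_setLIntegral_comp_mul ht]
  calc
    decreasingRearrangement μ f t = ∫⁻ _ in Ioo (0 : ℝ) 1, decreasingRearrangement μ f t := by simp
    _ ≤ ∫⁻ σ in Ioo (0 : ℝ) 1, decreasingRearrangement μ f (σ * t) :=
      setLIntegral_mono' measurableSet_Ioo fun σ hσ =>
        decreasingRearrangement_antitone μ f (mul_le_of_le_one_left ht.le hσ.2.le)

theorem measurable_maximalRearrangement (μ : Measure α) (f : α → ℝ) :
    Measurable (maximalRearrangement μ f) := by
  have hmono : Monotone fun t : ℝ => ∫⁻ τ in Ioo (0 : ℝ) t, decreasingRearrangement μ f τ :=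
    fun _ _ h => lintegral_mono_set (Ioo_subset_Ioo_right h)
  exact hmono.measurable.div ENNReal.measurable_ofReal

theorem lorentzQuasiNorm_le_lorentzNorm (p : ℝ) (q : ℝ≥0∞) (μ : Measure α) (f : α → ℝ) :
    lorentzQuasiNorm p q μ f ≤ lorentzNorm p q μ f := by
  refine eLpNorm_mono_enorm_ae ?_
  filter_upwards [ae_restrict_mem measurableSet_Ioi] with t ht
  simp only [enorm_eq_self]
  gcongr
  exact decreasingRearrangement_le_maximalRearrangement ht

theorem lorentzQuasiNorm_mono_measure (p : ℝ) (q : ℝ≥0∞) (h : ν ≤ μ) (f : α → ℝ) :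
    lorentzQuasiNorm p q ν f ≤ lorentzQuasiNorm p q μ f := by
  refine eLpNorm_mono_enorm_ae ?_
  filter_upwards [ae_restrict_mem measurableSet_Ioi] with t ht
  simp only [enorm_eq_self]
  gcongr
  exact decreasingRearrangement_mono_measure h f ht

theorem rpow_mul_maximalRearrangement (a : ℝ) (ht : 0 < t) :
    ENNReal.ofReal (t ^ a) * maximalRearrangement μ f t =
      ∫⁻ σ in Ioo (0 : ℝ) 1, ENNReal.ofReal (σ ^ (-a)) *
        (ENNReal.ofReal ((σ * t) ^ a) * decreasingRearrangement μ f (σ * t)) := by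
  have hmeas := measurable_decreasingRearrangement μ f
  rw [maximalRearrangement_eq_setLIntegral_comp_mul ht, ← lintegral_const_mul _ (by fun_prop)]
  refine setLIntegral_congr_fun measurableSet_Ioo fun σ hσ => ?_
  rw [← mul_assoc, ← ENNReal.ofReal_mul (Real.rpow_nonneg hσ.1.le _),
    Real.mul_rpow hσ.1.le ht.le, ← mul_assoc, ← Real.rpow_add hσ.1]
  simp

theorem lorentzNorm_two_le_lorentzQuasiNorm (hp : 1 < p) (μ : Measure α) (f : α → ℝ) :
    lorentzNorm p 2 μ f ≤ ENNReal.ofReal (p / (p - 1)) * lorentzQuasiNorm p 2 μ f := by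
  have hp0 : 0 < p := one_pos.trans hp
  have hmeas := measurable_decreasingRearrangement μ f
  have hint : ∫⁻ σ in Ioo (0 : ℝ) 1, ENNReal.ofReal (σ ^ (-(1 / p - 1 / (2 : ℝ≥0∞).toReal))) *
      ENNReal.ofReal (σ ^ (-1 / 2 : ℝ)) = ENNReal.ofReal (p / (p - 1)) := by
    have hexp : -1 < -(1 / p) := by
      rw [neg_lt_neg_iff, div_lt_one hp0]
      exact hp
    calc
      _ = ∫⁻ σ in Ioc (0 : ℝ) 1, ENNReal.ofReal (σ ^ (-(1 / p))) := by
        rw [← setLIntegral_congr Ioo_ae_eq_Ioc]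
        refine setLIntegral_congr_fun measurableSet_Ioo fun σ hσ => ?_
        rw [← ENNReal.ofReal_mul (Real.rpow_nonneg hσ.1.le _), ← Real.rpow_add hσ.1,
          ENNReal.toReal_ofNat]
        ring_nf
      _ = ENNReal.ofReal (1 ^ (-(1 / p) + 1) / (-(1 / p) + 1)) :=
        lintegral_Ioc_rpow hexp zero_le_one
      _ = ENNReal.ofReal (p / (p - 1)) := by
        rw [Real.one_rpow]
        congr 1
        field_simp
        ring_nf
  rw [lorentzNorm, eLpNorm_congr_ae ((ae_restrict_iff' measurableSet_Ioi).2
    (.of_forall fun t ht => rpow_mul_maximalRearrangement _ ht)), ← hint]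
  exact eLpNorm_two_lintegral_mul_comp_mul_le (l := fun σ => σ)
    (g := fun t => ENNReal.ofReal (t ^ (1 / p - 1 / (2 : ℝ≥0∞).toReal)) *
      decreasingRearrangement μ f t) (by fun_prop) measurable_id
    ((ae_restrict_iff' measurableSet_Ioo).2 <| .of_forall fun σ hσ => hσ.1) (by fun_prop)

theorem lorentzQuasiNorm_two_two (hf : AEMeasurable f μ) :
    lorentzQuasiNorm 2 2 μ f = eLpNorm f 2 μ := by
  rw [eLpNorm_eq_lintegral_rpow_enorm_toReal (by norm_num) (by norm_num),
    ← lintegral_rpow_decreasingRearrangement (by norm_num) hf, lorentzQuasiNorm,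
    eLpNorm_two_eq_lintegral_sq]
  simp

theorem eLpNorm_two_maximalRearrangement_le (hf : AEMeasurable f μ) :
    eLpNorm (maximalRearrangement μ f) 2 (volume.restrict (Ioi 0)) ≤ 2 * eLpNorm f 2 μ := by
  have h := lorentzNorm_two_le_lorentzQuasiNorm one_lt_two μ f
  rw [lorentzQuasiNorm_two_two hf, lorentzNorm] at h
  norm_num at h
  exact h

theorem measure_le_liminf_of_ae_eventually_mem {A : Set α} {B : ℕ → Set α}
    (h : ∀ᵐ x ∂μ, x ∈ A → ∀ᶠ n in Filter.atTop, x ∈ B n) :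
    μ A ≤ Filter.liminf (fun n => μ (B n)) Filter.atTop := by
  calc
    μ A ≤ μ (⋃ n, ⋂ i ≥ n, B i) := by
      refine measure_mono_ae (h.mono fun x hx hA => ?_)
      obtain ⟨n, hn⟩ := Filter.eventually_atTop.1 (hx hA)
      exact mem_iUnion.2 ⟨n, mem_iInter₂.2 hn⟩
    _ = ⨆ n, μ (⋂ i ≥ n, B i) := by
      refine Monotone.measure_iUnion fun m n hmn => ?_
      exact biInter_subset_biInter_left fun i hi => hmn.trans hi
    _ ≤ Filter.liminf (fun n => μ (B n)) Filter.atTop := by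
      rw [Filter.liminf_eq_iSup_iInf_of_nat]
      gcongr with n
      exact le_iInf₂ fun i hi => measure_mono (biInter_subset_of_mem hi)

theorem distributionFunction_le_liminf {φ : ℕ → α → ℝ}
    (h : ∀ᵐ x ∂μ, Filter.Tendsto (fun n => φ n x) Filter.atTop (nhds (f x))) (s : ℝ) :
    distributionFunction μ f s ≤
      Filter.liminf (fun n => distributionFunction μ (φ n) s) Filter.atTop :=
  measure_le_liminf_of_ae_eventually_mem <| h.mono fun _ hx hs => hx.abs.eventually_const_lt hs

theorem decreasingRearrangement_le_liminf_of_lt {φ : ℕ → α → ℝ} {t' : ℝ}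
    (h : ∀ᵐ x ∂μ, Filter.Tendsto (fun n => φ n x) Filter.atTop (nhds (f x))) (ht : 0 < t)
    (htt' : t < t') :
    decreasingRearrangement μ f t' ≤
      Filter.liminf (fun n => decreasingRearrangement μ (φ n) t) Filter.atTop := by
  refine le_of_forall_lt fun c hc => ?_
  obtain ⟨s, -, hcs, hst⟩ := ENNReal.lt_iff_exists_real_btwn.1 hc
  have hdist : ENNReal.ofReal t <
      Filter.liminf (fun n => distributionFunction μ (φ n) s) Filter.atTop :=
    calc
      ENNReal.ofReal t < ENNReal.ofReal t' := (ENNReal.ofReal_lt_ofReal_iff (ht.trans htt')).2 htt'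
      _ ≤ distributionFunction μ f s :=
        le_distributionFunction_of_lt_decreasingRearrangement (ht.trans htt') hst
      _ ≤ _ := distributionFunction_le_liminf h s
  refine hcs.trans_le (Filter.le_liminf_of_le (by isBoundedDefault) ?_)
  exact (Filter.eventually_lt_of_lt_liminf hdist).mono fun n hn =>
    le_decreasingRearrangement ht hn.le

theorem ae_decreasingRearrangement_le_liminf {φ : ℕ → α → ℝ}
    (h : ∀ᵐ x ∂μ, Filter.Tendsto (fun n => φ n x) Filter.atTop (nhds (f x))) :
    ∀ᵐ t ∂volume.restrict (Ioi 0), decreasingRearrangement μ f t ≤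
      Filter.liminf (fun n => decreasingRearrangement μ (φ n) t) Filter.atTop := by
  have hcont : ∀ᵐ t : ℝ, ContinuousAt (decreasingRearrangement μ f) t :=
    (decreasingRearrangement_antitone μ f).countable_not_continuousAt.ae_notMem volume |>.mono
      fun t ht => not_not.1 ht
  rw [ae_restrict_iff' measurableSet_Ioi]
  filter_upwards [hcont] with t hct ht
  refine le_of_tendsto (hct.tendsto.mono_left (nhdsWithin_le_nhds (s := Ioi t))) ?_
  filter_upwards [self_mem_nhdsWithin] with t' ht'
  exact decreasingRearrangement_le_liminf_of_lt h ht ht'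

theorem eLpNorm_le_liminf_eLpNorm {q : ℝ≥0∞} (hq : q ≠ 0) (hq' : q ≠ ∞) {g : α → ℝ≥0∞}
    {G : ℕ → α → ℝ≥0∞} (hG : ∀ n, Measurable (G n))
    (h : ∀ᵐ x ∂μ, g x ≤ Filter.liminf (fun n => G n x) Filter.atTop) :
    eLpNorm g q μ ≤ Filter.liminf (fun n => eLpNorm (G n) q μ) Filter.atTop := by
  have hq0 : 0 < q.toReal := ENNReal.toReal_pos hq hq'
  have hroot := (ENNReal.orderIsoRpow _ (one_div_pos.2 hq0)).liminf_apply
    (u := fun n => ∫⁻ x, G n x ^ q.toReal ∂μ) (f := Filter.atTop)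
  simp only [ENNReal.orderIsoRpow_apply] at hroot
  simp only [eLpNorm_eq_lintegral_rpow_enorm_toReal hq hq', enorm_eq_self]
  rw [← hroot]
  refine ENNReal.rpow_le_rpow ?_ (by positivity)
  refine (lintegral_mono_ae <| h.mono fun x hx => ?_).trans
    (lintegral_liminf_le fun n => (hG n).pow_const _)
  exact (ENNReal.rpow_le_rpow hx hq0.le).trans_eq
    ((ENNReal.orderIsoRpow _ hq0).liminf_apply (u := fun n => G n x))

theorem lorentzQuasiNorm_le_liminf {φ : ℕ → α → ℝ} {q : ℝ≥0∞} (hq : q ≠ 0) (hq' : q ≠ ∞)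
    (h : ∀ᵐ x ∂μ, Filter.Tendsto (fun n => φ n x) Filter.atTop (nhds (f x))) :
    lorentzQuasiNorm p q μ f ≤
      Filter.liminf (fun n => lorentzQuasiNorm p q μ (φ n)) Filter.atTop := by
  have hmeas n := measurable_decreasingRearrangement μ (φ n)
  refine eLpNorm_le_liminf_eLpNorm hq hq' (fun n => by fun_prop) ?_
  filter_upwards [ae_decreasingRearrangement_le_liminf h] with t ht
  rw [ENNReal.liminf_const_mul_of_ne_top ENNReal.ofReal_ne_top]
  gcongr

end LorentzNorms

section Potential

/-- The operator norm of the Hessian of `φ`, written `|D²φ|`. -/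
noncomputable def hessianNorm {E : Type*} [NormedAddCommGroup E] [NormedSpace ℝ E]
    (φ : E → ℝ) (x : E) : ℝ :=
  ‖fderiv ℝ (fderiv ℝ φ) x‖

theorem enorm_le_lintegral_mul_of_hasCompactSupport {g g' g'' : ℝ → ℝ}
    (hg : ∀ r, HasDerivAt g (g' r) r) (hg' : ∀ r, HasDerivAt g' (g'' r) r)
    (hg'' : Continuous g'') (hc : HasCompactSupport g) :
    ‖g 0‖ₑ ≤ ∫⁻ r in Ioi 0, ENNReal.ofReal r * ‖g'' r‖ₑ := by
  have hdg : deriv g = g' := funext fun r => (hg r).deriv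
  have hc' : HasCompactSupport g' := hdg ▸ hc.deriv
  have hh (r : ℝ) : HasDerivAt (fun r => r * g' r - g r) (r * g'' r) r := by
    convert! ((hasDerivAt_id r).mul (hg' r)).sub (hg r) using 1
    simp
  have hdh : deriv (fun r => r * g' r - g r) = fun r => r * g'' r := funext fun r => (hh r).deriv
  have hC1 : ContDiff ℝ 1 (fun r => r * g' r - g r) := by
    rw [contDiff_one_iff_deriv, hdh]
    exact ⟨fun r => (hh r).differentiableAt, by fun_prop⟩
  have hcs : HasCompactSupport fun r => r * g' r - g r := (hc'.mul_left).sub hc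
  have h0 : g 0 = ∫ r in Ioi 0, r * g'' r := by
    have h := hcs.integral_Ioi_deriv_eq hC1 0
    rw [hdh] at h
    linarith
  rw [h0]
  refine (enorm_integral_le_lintegral_enorm _).trans_eq ?_
  refine setLIntegral_congr_fun measurableSet_Ioi fun r (hr : 0 < r) => ?_
  rw [enorm_mul, Real.enorm_eq_ofReal hr.le]

variable {E : Type*} [NormedAddCommGroup E] [NormedSpace ℝ E] {φ : E → ℝ}

theorem continuous_hessianNorm (hφ : ContDiff ℝ 2 φ) : Continuous (hessianNorm φ) :=
  ((hφ.fderiv_right (m := 1) (by norm_num)).continuous_fderiv (by norm_num)).norm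

theorem hasCompactSupport_hessianNorm (hc : HasCompactSupport φ) :
    HasCompactSupport (hessianNorm φ) := by
  refine HasCompactSupport.mono ((hc.fderiv ℝ).fderiv ℝ) fun x hx h => hx ?_
  rw [hessianNorm, h, ContinuousLinearMap.opNorm_zero]

theorem hasDerivAt_comp_add_smul {F : Type*} [NormedAddCommGroup F] [NormedSpace ℝ F] {f : E → F}
    (hf : Differentiable ℝ f) (x z : E) (r : ℝ) :
    HasDerivAt (fun r : ℝ => f (x + r • z)) (fderiv ℝ f (x + r • z) z) r := by
  have hline : HasDerivAt (fun r : ℝ => x + r • z) z r := by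
    simpa using ((hasDerivAt_id r).smul_const z).const_add x
  exact (hf _).hasFDerivAt.comp_hasDerivAt r hline

theorem enorm_le_lintegral_mul_hessianNorm_comp_ray (hφ : ContDiff ℝ 2 φ) (hc : HasCompactSupport φ)
    (x : E) {z : E} (hz0 : z ≠ 0) (hz : ‖z‖ ≤ 1) :
    ‖φ x‖ₑ ≤ ∫⁻ r in Ioi (0 : ℝ), ENNReal.ofReal r * ‖hessianNorm φ (x + r • z)‖ₑ := by
  have hφ' : ContDiff ℝ 1 (fderiv ℝ φ) := hφ.fderiv_right (by norm_num)
  have hemb : Topology.IsClosedEmbedding fun r : ℝ => x + r • z :=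
    (Homeomorph.addLeft x).isClosedEmbedding.comp (isClosedEmbedding_smul_left hz0)
  have hsecond (r : ℝ) : HasDerivAt (fun r : ℝ => fderiv ℝ φ (x + r • z) z)
      (fderiv ℝ (fderiv ℝ φ) (x + r • z) z z) r := by
    simpa using (hasDerivAt_comp_add_smul (hφ'.differentiable (by norm_num)) x z r).clm_apply
      (hasDerivAt_const r z)
  have hcont : Continuous fun r : ℝ => fderiv ℝ (fderiv ℝ φ) (x + r • z) z z := by
    have := hφ'.continuous_fderiv (by norm_num)
    fun_prop
  have h := enorm_le_lintegral_mul_of_hasCompactSupport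
    (hasDerivAt_comp_add_smul (hφ.differentiable (by norm_num)) x z) hsecond hcont
    (hc.comp_isClosedEmbedding hemb)
  simp only [zero_smul, add_zero] at h
  refine h.trans (lintegral_mono fun r => ?_)
  gcongr
  rw [enorm_le_iff_norm_le, hessianNorm, norm_norm (fderiv ℝ (fderiv ℝ φ) _)]
  calc
    _ ≤ ‖fderiv ℝ (fderiv ℝ φ) (x + r • z)‖ * ‖z‖ * ‖z‖ := ContinuousLinearMap.le_opNorm₂ _ _ _
    _ ≤ ‖fderiv ℝ (fderiv ℝ φ) (x + r • z)‖ * 1 * 1 := by gcongr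
    _ = _ := by ring

variable [MeasurableSpace E] [BorelSpace E] [FiniteDimensional ℝ E] {μ : Measure E}
  [μ.IsAddHaarMeasure]

theorem measure_ball_mul_enorm_le_lintegral_setLIntegral [Nontrivial E] (hφ : ContDiff ℝ 2 φ)
    (hc : HasCompactSupport φ) (x : E) :
    μ (Metric.ball 0 1) * ‖φ x‖ₑ ≤ ∫⁻ r in Ioi (0 : ℝ),
      ENNReal.ofReal r * ∫⁻ z in Metric.ball 0 1, ‖hessianNorm φ (x + r • z)‖ₑ ∂μ := by
  have hH := (continuous_hessianNorm hφ).measurable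
  calc
    μ (Metric.ball 0 1) * ‖φ x‖ₑ = ∫⁻ _z in Metric.ball (0 : E) 1, ‖φ x‖ₑ ∂μ := by
      rw [setLIntegral_const, mul_comm]
    _ ≤ ∫⁻ z in Metric.ball (0 : E) 1, (∫⁻ r in Ioi (0 : ℝ),
          ENNReal.ofReal r * ‖hessianNorm φ (x + r • z)‖ₑ) ∂μ := by
      refine lintegral_mono_ae ?_
      have hne : ∀ᵐ z ∂μ, z ≠ 0 := by simp [ae_iff]
      filter_upwards [ae_restrict_of_ae hne, ae_restrict_mem measurableSet_ball] with z hz hzb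
      exact enorm_le_lintegral_mul_hessianNorm_comp_ray hφ hc x hz
        (by simpa using (Metric.mem_ball.1 hzb).le)
    _ = _ := by
      rw [lintegral_lintegral_swap (Measurable.aemeasurable (by fun_prop))]
      exact lintegral_congr fun r => lintegral_const_mul _ (by fun_prop)

theorem setLIntegral_enorm_comp_add_smul_le {f : E → ℝ} (hf : Measurable f) {A : Set E}
    (hA : μ A ≠ ∞) (v : E) {r : ℝ} (hr : 0 < r) :
    ∫⁻ z in A, ‖f (v + r • z)‖ₑ ∂μ ≤
      μ A * maximalRearrangement μ f ((μ A).toReal * r ^ Module.finrank ℝ E) := by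
  have hrd : 0 < r ^ Module.finrank ℝ E := pow_pos hr _
  have hemb : MeasurableEmbedding fun z : E => v + r • z :=
    (measurableEmbedding_addLeft v).comp (measurableEmbedding_const_smul₀ hr.ne')
  have hmap : μ.map (fun z => v + r • z) = ENNReal.ofReal (r ^ Module.finrank ℝ E)⁻¹ • μ := by
    rw [show (fun z => v + r • z) = (v + ·) ∘ (r • ·) from rfl,
      ← Measure.map_map (measurable_const_add v) (measurable_const_smul r),
      Measure.map_addHaar_smul μ hr.ne', Measure.map_smul, map_add_left_eq_self,
      abs_of_pos (inv_pos.2 hrd)]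
  have himage : μ ((fun z => v + r • z) '' A) = ENNReal.ofReal (r ^ Module.finrank ℝ E) * μ A := by
    rw [← image_image (v + ·) (r • ·), image_add_left, measure_preimage_add, image_smul,
      Measure.addHaar_smul, abs_of_pos hrd]
  have himage_top : μ ((fun z => v + r • z) '' A) ≠ ∞ :=
    himage ▸ ENNReal.mul_ne_top ENNReal.ofReal_ne_top hA
  have h := setLIntegral_enorm_le_mul_maximalRearrangement himage_top hf.aemeasurable
  calc
    ∫⁻ z in A, ‖f (v + r • z)‖ₑ ∂μ =
        ∫⁻ y in (fun z => v + r • z) '' A, ‖f y‖ₑ ∂μ.map (fun z => v + r • z) := by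
      rw [hemb.restrict_map, hemb.lintegral_map, preimage_image_eq _ hemb.injective]
    _ ≤ ENNReal.ofReal (r ^ Module.finrank ℝ E)⁻¹ * (ENNReal.ofReal (r ^ Module.finrank ℝ E) *
          μ A * maximalRearrangement μ f ((μ A).toReal * r ^ Module.finrank ℝ E)) := by
      rw [hmap, Measure.restrict_smul, lintegral_smul_measure, smul_eq_mul]
      gcongr
      rwa [himage, ENNReal.toReal_mul, ENNReal.toReal_ofReal hrd.le,
        mul_comm _ (μ A).toReal] at h
    _ = _ := by
      rw [← mul_assoc, ← mul_assoc, ← ENNReal.ofReal_mul (inv_nonneg.2 hrd.le),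
        inv_mul_cancel₀ hrd.ne', ENNReal.ofReal_one, one_mul]

theorem setLIntegral_setLIntegral_ball_enorm_le {f : E → ℝ} (hf : Measurable f) {A : Set E}
    (hA : μ A ≠ ∞) {r : ℝ} (hr : 0 < r) :
    ∫⁻ x in A, ∫⁻ z in Metric.ball 0 1, ‖f (x + r • z)‖ₑ ∂μ ∂μ ≤
      μ A * (μ (Metric.ball 0 1) * maximalRearrangement μ f
        (max (μ A).toReal ((μ (Metric.ball 0 1)).toReal * r ^ Module.finrank ℝ E))) := by
  rcases max_choice (μ A).toReal ((μ (Metric.ball (0 : E) 1)).toReal * r ^ Module.finrank ℝ E)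
    with h | h <;> rw [h]
  · rw [lintegral_lintegral_swap (Measurable.aemeasurable (by fun_prop)), mul_left_comm,
      mul_comm (μ (Metric.ball _ _)), ← setLIntegral_const]
    refine lintegral_mono fun z => ?_
    simpa [add_comm] using setLIntegral_enorm_comp_add_smul_le hf hA (r • z) one_pos
  · rw [mul_comm, ← setLIntegral_const]
    exact lintegral_mono fun x =>
      setLIntegral_enorm_comp_add_smul_le hf measure_ball_lt_top.ne x hr

theorem setLIntegral_enorm_le_mul_lintegral_maximalRearrangement [Nontrivial E]
    (hφ : ContDiff ℝ 2 φ) (hc : HasCompactSupport φ) {A : Set E} (hA : μ A ≠ ∞) :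
    ∫⁻ x in A, ‖φ x‖ₑ ∂μ ≤ μ A * ∫⁻ r in Ioi (0 : ℝ), ENNReal.ofReal r *
      maximalRearrangement μ (hessianNorm φ)
        (max (μ A).toReal ((μ (Metric.ball (0 : E) 1)).toReal * r ^ Module.finrank ℝ E)) := by
  have hH := (continuous_hessianNorm hφ).measurable
  have hφm := hφ.continuous.measurable
  have hmax := measurable_maximalRearrangement μ (hessianNorm φ)
  have hb0 : μ (Metric.ball (0 : E) 1) ≠ 0 := (Metric.measure_ball_pos μ 0 one_pos).ne'
  have hb : μ (Metric.ball (0 : E) 1) ≠ ∞ := measure_ball_lt_top.ne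
  rw [← ENNReal.mul_le_mul_iff_right hb0 hb, ← lintegral_const_mul _ (by fun_prop)]
  calc
    _ ≤ ∫⁻ x in A, (∫⁻ r in Ioi (0 : ℝ), ENNReal.ofReal r *
          ∫⁻ z in Metric.ball 0 1, ‖hessianNorm φ (x + r • z)‖ₑ ∂μ) ∂μ :=
      lintegral_mono fun x => measure_ball_mul_enorm_le_lintegral_setLIntegral hφ hc x
    _ = ∫⁻ r in Ioi (0 : ℝ), ENNReal.ofReal r *
          ∫⁻ x in A, ∫⁻ z in Metric.ball 0 1, ‖hessianNorm φ (x + r • z)‖ₑ ∂μ ∂μ := by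
      rw [lintegral_lintegral_swap (Measurable.aemeasurable (by fun_prop))]
      exact lintegral_congr fun r => lintegral_const_mul _ (by fun_prop)
    _ ≤ ∫⁻ r in Ioi (0 : ℝ), ENNReal.ofReal r * (μ A * (μ (Metric.ball (0 : E) 1) *
          maximalRearrangement μ (hessianNorm φ)
            (max (μ A).toReal ((μ (Metric.ball (0 : E) 1)).toReal * r ^ Module.finrank ℝ E)))) :=
      setLIntegral_mono' measurableSet_Ioi fun r hr => by
        gcongr
        exact setLIntegral_setLIntegral_ball_enorm_le hH hA hr
    _ = _ := by
      rw [← mul_assoc, ← lintegral_const_mul _ (by fun_prop)]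
      exact lintegral_congr fun r => by ring

theorem decreasingRearrangement_le_lintegral_maximalRearrangement [Nontrivial E]
    (hφ : ContDiff ℝ 2 φ) (hc : HasCompactSupport φ) {t : ℝ} (ht : 0 < t) :
    decreasingRearrangement μ φ t ≤ ∫⁻ r in Ioi (0 : ℝ), ENNReal.ofReal r *
      maximalRearrangement μ (hessianNorm φ)
        (max t ((μ (Metric.ball (0 : E) 1)).toReal * r ^ Module.finrank ℝ E)) := by
  refine le_of_forall_lt fun c hc' => ?_
  obtain ⟨s, hs0, hcs, hst⟩ := ENNReal.lt_iff_exists_real_btwn.1 hc'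
  refine hcs.trans_le ?_
  have hφm := hφ.continuous.measurable
  have htA := le_distributionFunction_of_lt_decreasingRearrangement ht hst
  set A := {x | s < |φ x|}
  have hAtop : μ A ≠ ∞ := by
    refine ((measure_mono fun x hx => subset_tsupport φ ?_).trans_lt
      (IsCompact.measure_lt_top hc)).ne
    exact abs_pos.1 (hs0.trans_lt (mem_ofPred.1 hx))
  have htA' : t ≤ (μ A).toReal := (ENNReal.ofReal_le_iff_le_toReal hAtop).1 htA
  have hA0 : μ A ≠ 0 := ((ENNReal.ofReal_pos.2 ht).trans_le htA).ne'
  rw [← ENNReal.mul_le_mul_iff_right hA0 hAtop]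
  calc
    μ A * ENNReal.ofReal s ≤ ∫⁻ x in A, ‖φ x‖ₑ ∂μ := by
      rw [mul_comm, ← setLIntegral_const]
      refine setLIntegral_mono' (measurableSet_lt (by fun_prop) (by fun_prop)) fun x hx => ?_
      rw [Real.enorm_eq_ofReal_abs]
      exact ENNReal.ofReal_le_ofReal (le_of_lt hx)
    _ ≤ _ := setLIntegral_enorm_le_mul_lintegral_maximalRearrangement hφ hc hAtop
    _ ≤ _ := by
      gcongr with r
      exact maximalRearrangement_le_of_le (lt_max_of_lt_left ht) (max_le_max_right _ htA')

end Potential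

section CriticalEstimate

theorem lintegral_Ioi_rpow {p c : ℝ} (hp : p < -1) (hc : 0 < c) :
    ∫⁻ t in Ioi c, ENNReal.ofReal (t ^ p) = ENNReal.ofReal (-c ^ (p + 1) / (p + 1)) := by
  rw [← ofReal_integral_eq_lintegral_ofReal, integral_Ioi_rpow_of_lt hp hc]
  · exact integrableOn_Ioi_rpow_of_lt hp hc
  · exact (ae_restrict_iff' measurableSet_Ioi).2
      (.of_forall fun t ht => Real.rpow_nonneg (hc.trans ht).le _)

theorem lintegral_mul_rpow_max_one_pow {d : ℕ} (hd : 4 < d) :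
    ∫⁻ ρ in Ioi (0 : ℝ), ENNReal.ofReal ρ * ENNReal.ofReal (max 1 (ρ ^ d) ^ (-1 / 2 : ℝ)) =
      ENNReal.ofReal (d / (2 * (d - 4))) := by
  have hd' : (4 : ℝ) < d := by exact_mod_cast hd
  have hinner : ∫⁻ ρ in Ioc (0 : ℝ) 1,
      ENNReal.ofReal ρ * ENNReal.ofReal (max 1 (ρ ^ d) ^ (-1 / 2 : ℝ)) =
        ENNReal.ofReal (1 / 2) := by
    have h := lintegral_Ioc_rpow (p := 1) (c := 1) (by norm_num) zero_le_one
    norm_num at h ⊢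
    rw [← h]
    refine setLIntegral_congr_fun measurableSet_Ioc fun ρ hρ => ?_
    simp [max_eq_left (pow_le_one₀ hρ.1.le hρ.2)]
  have houter : ∫⁻ ρ in Ioi (1 : ℝ),
      ENNReal.ofReal ρ * ENNReal.ofReal (max 1 (ρ ^ d) ^ (-1 / 2 : ℝ)) =
        ENNReal.ofReal (2 / (d - 4)) := by
    have h := lintegral_Ioi_rpow (p := 1 - d / 2) (c := 1) (by linarith) one_pos
    rw [Real.one_rpow, show -1 / (1 - (d : ℝ) / 2 + 1) = 2 / (d - 4) by
      rw [div_eq_div_iff] <;> linarith] at h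
    rw [← h]
    refine setLIntegral_congr_fun measurableSet_Ioi fun ρ (hρ : 1 < ρ) => ?_
    have hρ0 : 0 < ρ := one_pos.trans hρ
    rw [max_eq_right (one_le_pow₀ hρ.le), ← ENNReal.ofReal_mul hρ0.le, ← Real.rpow_natCast,
      ← Real.rpow_mul hρ0.le, ← Real.rpow_one_add' hρ0.le (by linarith)]
    ring_nf
  rw [← Ioc_union_Ioi_eq_Ioi zero_le_one,
    lintegral_union measurableSet_Ioi (Ioc_disjoint_Ioi le_rfl), hinner, houter,
    ← ENNReal.ofReal_add (by norm_num) (div_nonneg two_pos.le (by linarith))]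
  congr 1
  have : (d : ℝ) - 4 ≠ 0 := by linarith
  field_simp
  ring

theorem rpow_mul_lintegral_comp_max_mul_pow {d : ℕ} (hd : d ≠ 0) {b t : ℝ} (hb : 0 < b)
    (ht : 0 < t) {F : ℝ → ℝ≥0∞} (hF : Measurable F) :
    ENNReal.ofReal (t ^ (-2 / (d : ℝ))) *
        ∫⁻ r in Ioi (0 : ℝ), ENNReal.ofReal r * F (max t (b * r ^ d)) =
      ENNReal.ofReal (b ^ (-2 / (d : ℝ))) *
        ∫⁻ ρ in Ioi (0 : ℝ), ENNReal.ofReal ρ * F (max 1 (ρ ^ d) * t) := by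
  have htb : 0 < t / b := div_pos ht hb
  -- The substitution is `r = c * ρ`, with `c` chosen so that `b * c ^ d = t`.
  set c := (t / b) ^ (d : ℝ)⁻¹ with hc
  have hc0 : 0 < c := Real.rpow_pos_of_pos htb _
  have hcd : b * c ^ d = t := by
    rw [hc, Real.rpow_inv_natCast_pow htb.le hd, mul_div_cancel₀ _ hb.ne']
  have hconst : t ^ (-2 / (d : ℝ)) * c * c = b ^ (-2 / (d : ℝ)) := by
    have hcc : c * c = (t / b) ^ (2 / (d : ℝ)) := by
      rw [hc, ← Real.rpow_add htb]
      ring_nf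
    rw [mul_assoc, hcc, Real.div_rpow ht.le hb.le, neg_div, Real.rpow_neg ht.le,
      Real.rpow_neg hb.le, ← mul_div_assoc,
      inv_mul_cancel₀ (Real.rpow_pos_of_pos ht _).ne', one_div]
  have hscale (r : ℝ) : max 1 ((c⁻¹ * r) ^ d) * t = max t (b * r ^ d) := by
    rw [max_mul_of_nonneg _ _ ht.le, one_mul, mul_pow, inv_pow]
    congr 1
    rw [← hcd]
    field_simp
  have hsubst := setLIntegral_Ioi_comp_mul_left (inv_pos.2 hc0) fun ρ : ℝ =>
    ENNReal.ofReal (c * ρ) * F (max 1 (ρ ^ d) * t)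
  simp only [mul_inv_cancel_left₀ hc0.ne', hscale, inv_inv, ENNReal.ofReal_mul hc0.le, mul_assoc]
    at hsubst
  rw [lintegral_const_mul _ (by fun_prop)] at hsubst
  rw [hsubst, ← hconst, ENNReal.ofReal_mul (by positivity), ENNReal.ofReal_mul (by positivity),
    mul_assoc, mul_assoc]

variable {E : Type*} [NormedAddCommGroup E] [NormedSpace ℝ E] [MeasurableSpace E] [BorelSpace E]
  [FiniteDimensional ℝ E] (μ : Measure E) [μ.IsAddHaarMeasure] {φ : E → ℝ}

theorem rpow_mul_decreasingRearrangement_le [Nontrivial E] (hφ : ContDiff ℝ 2 φ)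
    (hc : HasCompactSupport φ) {t : ℝ} (ht : 0 < t) :
    ENNReal.ofReal (t ^ (-2 / (Module.finrank ℝ E : ℝ))) * decreasingRearrangement μ φ t ≤
      ENNReal.ofReal ((μ (Metric.ball (0 : E) 1)).toReal ^ (-2 / (Module.finrank ℝ E : ℝ))) *
        ∫⁻ ρ in Ioi (0 : ℝ), ENNReal.ofReal ρ *
          maximalRearrangement μ (hessianNorm φ) (max 1 (ρ ^ Module.finrank ℝ E) * t) := by
  have hb : 0 < (μ (Metric.ball (0 : E) 1)).toReal :=
    ENNReal.toReal_pos (Metric.measure_ball_pos μ 0 one_pos).ne' measure_ball_lt_top.ne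
  rw [← rpow_mul_lintegral_comp_max_mul_pow Module.finrank_pos.ne' hb ht
    (measurable_maximalRearrangement μ (hessianNorm φ))]
  gcongr
  exact decreasingRearrangement_le_lintegral_maximalRearrangement hφ hc ht

theorem lorentzQuasiNorm_le_mul_eLpNorm_hessianNorm (hd : 4 < Module.finrank ℝ E)
    (hφ : ContDiff ℝ 2 φ) (hc : HasCompactSupport φ) :
    lorentzQuasiNorm (2 * Module.finrank ℝ E / (Module.finrank ℝ E - 4)) 2 μ φ ≤
      ENNReal.ofReal ((μ (Metric.ball (0 : E) 1)).toReal ^ (-2 / (Module.finrank ℝ E : ℝ)) *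
        (Module.finrank ℝ E / (Module.finrank ℝ E - 4))) * eLpNorm (hessianNorm φ) 2 μ := by
  have : Nontrivial E := Module.nontrivial_of_finrank_pos (R := ℝ) (by omega)
  have hmax := measurable_maximalRearrangement μ (hessianNorm φ)
  have hd' : (4 : ℝ) < Module.finrank ℝ E := by exact_mod_cast hd
  set d := Module.finrank ℝ E
  set B := ENNReal.ofReal ((μ (Metric.ball (0 : E) 1)).toReal ^ (-2 / (d : ℝ)))
  have hexp : 1 / (2 * (d : ℝ) / (d - 4)) - 1 / (2 : ℝ≥0∞).toReal = -2 / d := by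
    have : (d : ℝ) - 4 ≠ 0 := by linarith
    simp only [ENNReal.toReal_ofNat]
    field_simp
    ring
  calc
    _ ≤ eLpNorm (fun t => ∫⁻ ρ in Ioi (0 : ℝ), B * ENNReal.ofReal ρ *
          maximalRearrangement μ (hessianNorm φ) (max 1 (ρ ^ d) * t)) 2
          (volume.restrict (Ioi 0)) := by
      rw [lorentzQuasiNorm, hexp]
      refine eLpNorm_mono_enorm_ae ?_
      filter_upwards [ae_restrict_mem measurableSet_Ioi] with t ht
      simp only [mul_assoc, enorm_eq_self]
      rw [lintegral_const_mul _ (by fun_prop)]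
      exact rpow_mul_decreasingRearrangement_le μ hφ hc ht
    _ ≤ B * ENNReal.ofReal (d / (2 * (d - 4))) * (2 * eLpNorm (hessianNorm φ) 2 μ) := by
      refine (eLpNorm_two_lintegral_mul_comp_mul_le (by fun_prop) (by fun_prop)
        (.of_forall fun ρ => lt_max_of_lt_left one_pos) hmax).trans ?_
      simp only [mul_assoc B]
      rw [lintegral_const_mul _ (by fun_prop), lintegral_mul_rpow_max_one_pow hd,
        ← mul_assoc B]
      exact mul_le_mul_right (eLpNorm_two_maximalRearrangement_le
        (continuous_hessianNorm hφ).measurable.aemeasurable) _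
    _ = _ := by
      rw [show (d : ℝ) / (d - 4) = d / (2 * (d - 4)) * 2 by field_simp,
        ENNReal.ofReal_mul (by positivity), ENNReal.ofReal_mul' two_pos.le, ENNReal.ofReal_ofNat]
      ring

end CriticalEstimate

section SecondDerivatives

open scoped LineDeriv SchwartzMap

variable {E ι : Type*} [NormedAddCommGroup E] [InnerProductSpace ℝ E] [Fintype ι]

theorem sq_opNorm_le_sum_sq_norm_orthonormalBasis {F : Type*} [NormedAddCommGroup F]
    [NormedSpace ℝ F] (b : OrthonormalBasis ι ℝ E) (L : E →L[ℝ] F) :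
    ‖L‖ ^ 2 ≤ ∑ i, ‖L (b i)‖ ^ 2 := by
  have hsum : 0 ≤ ∑ i, ‖L (b i)‖ ^ 2 := Finset.sum_nonneg fun i _ => sq_nonneg _
  rw [← Real.le_sqrt (norm_nonneg _) hsum]
  refine L.opNorm_le_bound (Real.sqrt_nonneg _) fun v => ?_
  calc
    ‖L v‖ = ‖∑ i, b.repr v i • L (b i)‖ := by
      conv_lhs => rw [← b.sum_repr v, map_sum]
      simp only [map_smul]
    _ ≤ ∑ i, ‖L (b i)‖ * ‖b.repr v i‖ := by
      refine (norm_sum_le _ _).trans_eq (Finset.sum_congr rfl fun i _ => ?_)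
      rw [norm_smul, mul_comm]
    _ ≤ √(∑ i, ‖L (b i)‖ ^ 2) * √(∑ i, ‖b.repr v i‖ ^ 2) :=
      Real.sum_mul_le_sqrt_mul_sqrt _ _ _
    _ = √(∑ i, ‖L (b i)‖ ^ 2) * ‖v‖ := by
      rw [← EuclideanSpace.norm_eq, LinearIsometryEquiv.norm_map]

theorem sq_hessianNorm_le_sum (b : OrthonormalBasis ι ℝ E) (φ : E → ℝ) (x : E) :
    hessianNorm φ x ^ 2 ≤ ∑ i, ∑ j, (fderiv ℝ (fderiv ℝ φ) x (b i) (b j)) ^ 2 := by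
  refine (sq_opNorm_le_sum_sq_norm_orthonormalBasis b _).trans (Finset.sum_le_sum fun i _ => ?_)
  simpa only [Real.norm_eq_abs, sq_abs] using sq_opNorm_le_sum_sq_norm_orthonormalBasis b
    (fderiv ℝ (fderiv ℝ φ) x (b i))

theorem lineDerivOp_lineDerivOp_apply (f : 𝓢(E, ℝ)) (v w x : E) :
    (∂_{v} (∂_{w} f) : 𝓢(E, ℝ)) x = fderiv ℝ (fderiv ℝ f) x v w := by
  have h := SchwartzMap.iteratedLineDerivOp_eq_iteratedFDeriv (m := ![v, w]) (f := f) (x := x)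
  rw [iteratedFDeriv_two_apply] at h
  simpa [LineDeriv.iteratedLineDerivOp_succ_left] using h

theorem lineDerivOp_comm (f : 𝓢(E, ℝ)) (v w : E) :
    (∂_{v} (∂_{w} f) : 𝓢(E, ℝ)) = ∂_{w} (∂_{v} f) := by
  ext x
  rw [lineDerivOp_lineDerivOp_apply, lineDerivOp_lineDerivOp_apply]
  exact ((f.smooth 2).contDiffAt.isSymmSndFDerivAt (by simp)) v w

variable [FiniteDimensional ℝ E] [MeasurableSpace E] [BorelSpace E]

theorem integrable_schwartzMap_mul (f g : 𝓢(E, ℝ)) : Integrable (fun x => f x * g x) :=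
  (SchwartzMap.pairing (ContinuousLinearMap.mul ℝ ℝ) f g).integrable

theorem integral_sq_lineDerivOp_lineDerivOp (f : 𝓢(E, ℝ)) (v w : E) :
    ∫ x, (∂_{v} (∂_{w} f) : 𝓢(E, ℝ)) x ^ 2
      = ∫ x, (∂_{v} (∂_{v} f) : 𝓢(E, ℝ)) x * (∂_{w} (∂_{w} f) : 𝓢(E, ℝ)) x := by
  simp_rw [pow_two]
  rw [SchwartzMap.integral_mul_lineDerivOp_right_eq_neg_left, lineDerivOp_comm f v w,
    lineDerivOp_comm _ v w, ← SchwartzMap.integral_mul_lineDerivOp_right_eq_neg_left]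

theorem sum_integral_sq_lineDerivOp (b : OrthonormalBasis ι ℝ E) (f : 𝓢(E, ℝ)) :
    ∑ i, ∑ j, ∫ x, (∂_{b i} (∂_{b j} f) : 𝓢(E, ℝ)) x ^ 2 = ∫ x, (Δ f : 𝓢(E, ℝ)) x ^ 2 := by
  simp_rw [integral_sq_lineDerivOp_lineDerivOp, SchwartzMap.laplacian_eq_sum b f,
    _root_.sum_apply, pow_two, Finset.sum_mul_sum]
  rw [integral_finsetSum _ fun i _ =>
    integrable_finsetSum _ fun j _ => integrable_schwartzMap_mul _ _]
  refine Finset.sum_congr rfl fun i _ => ?_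
  rw [integral_finsetSum _ fun j _ => integrable_schwartzMap_mul _ _]

theorem integral_sq_hessianNorm_le (f : 𝓢(E, ℝ)) :
    ∫ x, hessianNorm f x ^ 2 ≤ ∫ x, (Δ f : 𝓢(E, ℝ)) x ^ 2 := by
  have b := stdOrthonormalBasis ℝ E
  have hint i j : Integrable fun x => (∂_{b i} (∂_{b j} f) : 𝓢(E, ℝ)) x ^ 2 := by
    simpa only [pow_two] using integrable_schwartzMap_mul _ _
  calc
    ∫ x, hessianNorm f x ^ 2 ≤ ∫ x, ∑ i, ∑ j, (∂_{b i} (∂_{b j} f) : 𝓢(E, ℝ)) x ^ 2 := by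
      refine integral_mono_of_nonneg (.of_forall fun x => sq_nonneg _)
        (integrable_finsetSum _ fun i _ => integrable_finsetSum _ fun j _ => hint i j)
        (.of_forall fun x => ?_)
      simpa only [lineDerivOp_lineDerivOp_apply] using sq_hessianNorm_le_sum b f x
    _ = ∑ i, ∑ j, ∫ x, (∂_{b i} (∂_{b j} f) : 𝓢(E, ℝ)) x ^ 2 := by
      rw [integral_finsetSum _ fun i _ => integrable_finsetSum _ fun j _ => hint i j]
      exact Finset.sum_congr rfl fun i _ => integral_finsetSum _ fun j _ => hint i j
    _ = _ := sum_integral_sq_lineDerivOp b f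

theorem eLpNorm_hessianNorm_le_eLpNorm_laplacian {φ : E → ℝ} (hφ : ContDiff ℝ (⊤ : ℕ∞) φ)
    (hc : HasCompactSupport φ) : eLpNorm (hessianNorm φ) 2 volume ≤ eLpNorm (Δ φ) 2 volume := by
  have hL (f : 𝓢(E, ℝ)) : Δ ⇑f = ⇑(Δ f : 𝓢(E, ℝ)) := funext fun x => (f.laplacian_apply x).symm
  have hH : MemLp (hessianNorm φ) 2 volume :=
    (continuous_hessianNorm (contDiff_infty.1 hφ 2)).memLp_of_hasCompactSupport
      (hasCompactSupport_hessianNorm hc)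
  obtain ⟨f, rfl⟩ : ∃ f : 𝓢(E, ℝ), ⇑f = φ := ⟨hc.toSchwartzMap hφ, rfl⟩
  rw [hL, hH.eLpNorm_eq_integral_rpow_norm (by norm_num) (by norm_num),
    ((Δ f : 𝓢(E, ℝ)).memLp 2 volume).eLpNorm_eq_integral_rpow_norm (by norm_num) (by norm_num)]
  refine ENNReal.ofReal_le_ofReal (Real.rpow_le_rpow (by positivity) ?_ (by norm_num))
  simpa only [ENNReal.toReal_ofNat, Real.rpow_ofNat, Real.norm_eq_abs, sq_abs] using
    integral_sq_hessianNorm_le f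

theorem integral_laplacian_mul {f g : E → ℝ} (hf : ContDiff ℝ (⊤ : ℕ∞) f)
    (hcf : HasCompactSupport f) (hg : ContDiff ℝ (⊤ : ℕ∞) g) (hcg : HasCompactSupport g) :
    ∫ x, Δ f x * g x = ∫ x, f x * Δ g x := by
  have h := SchwartzMap.integral_mul_laplacian_right_eq_left (μ := volume)
    (hcf.toSchwartzMap hf) (hcg.toSchwartzMap hg)
  simp_rw [SchwartzMap.laplacian_apply] at h
  exact h.symm

end SecondDerivatives

section Sobolev

variable {E : Type*} [NormedAddCommGroup E] [NormedSpace ℝ E] [FiniteDimensional ℝ E]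
  [MeasurableSpace E] [BorelSpace E]

theorem exists_eLpNorm_le_mul_eLpNorm_hessianNorm (μ : Measure E) [μ.IsAddHaarMeasure]
    {p p' : ℝ≥0} (hp : 1 ≤ p) (hd : 0 < Module.finrank ℝ E)
    (hp' : (p' : ℝ)⁻¹ = (p : ℝ)⁻¹ - 2 * (Module.finrank ℝ E : ℝ)⁻¹) :
    ∃ C : ℝ≥0, ∀ φ : E → ℝ, ContDiff ℝ 2 φ → HasCompactSupport φ →
      eLpNorm φ p' μ ≤ C * eLpNorm (hessianNorm φ) p μ := by
  have hd' : 0 < (Module.finrank ℝ E : ℝ)⁻¹ := by positivity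
  have hp1 : (p : ℝ)⁻¹ ≤ 1 := inv_le_one_of_one_le₀ (mod_cast hp)
  have hp'' : 0 ≤ (p' : ℝ)⁻¹ := by positivity
  obtain ⟨r, hr⟩ : ∃ r : ℝ≥0, (r : ℝ)⁻¹ = (p : ℝ)⁻¹ - (Module.finrank ℝ E : ℝ)⁻¹ :=
    ⟨.mk ((p : ℝ)⁻¹ - (Module.finrank ℝ E : ℝ)⁻¹)⁻¹ (inv_nonneg.2 (by linarith)), inv_inv _⟩
  have hr0 : 0 < (r : ℝ)⁻¹ := by linarith
  have hr1 : 1 ≤ r := by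
    rw [← NNReal.coe_le_coe, NNReal.coe_one, ← inv_le_one₀ (inv_pos.1 hr0)]
    linarith
  refine ⟨SNormLESNormFDerivOfEqConst ℝ μ r * SNormLESNormFDerivOfEqConst (E →L[ℝ] ℝ) μ p,
    fun φ hφ hc => ?_⟩
  calc
    eLpNorm φ p' μ ≤ SNormLESNormFDerivOfEqConst ℝ μ r * eLpNorm (fderiv ℝ φ) r μ :=
      eLpNorm_le_eLpNorm_fderiv_of_eq μ (hφ.of_le one_le_two) hc hr1 hd (by
        push_cast
        linarith)
    _ ≤ SNormLESNormFDerivOfEqConst ℝ μ r * (SNormLESNormFDerivOfEqConst (E →L[ℝ] ℝ) μ p *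
        eLpNorm (fderiv ℝ (fderiv ℝ φ)) p μ) := by
      gcongr
      exact eLpNorm_le_eLpNorm_fderiv_of_eq μ (hφ.fderiv_right (by norm_num)) (hc.fderiv ℝ)
        hp hd hr
    _ = _ := by
      rw [ENNReal.coe_mul, mul_assoc, ← eLpNorm_norm (fderiv ℝ (fderiv ℝ φ))]
      rfl

end Sobolev

section Embedding

open Filter Topology

variable {N : ℕ} {Ω : Opens (EuclideanSpace ℝ (Fin N))} {p : ℝ≥0∞}

theorem support_laplacian_subset_tsupport {E : Type*} [NormedAddCommGroup E]
    [InnerProductSpace ℝ E] [FiniteDimensional ℝ E] (f : E → ℝ) :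
    Function.support (Δ f) ⊆ tsupport f := by
  refine Function.support_subset_iff'.2 fun x hx => ?_
  rw [(InnerProductSpace.laplacian_congr_nhds
    (notMem_tsupport_iff_eventuallyEq.1 hx)).eq_of_nhds]
  exact congrFun InnerProductSpace.laplacian_const x

namespace SmoothCompact

theorem contDiff (φ : SmoothCompact Ω) : ContDiff ℝ (⊤ : ℕ∞) φ.toFun :=
  TestFunction.contDiff' φ

theorem hasCompactSupport (φ : SmoothCompact Ω) : HasCompactSupport φ.toFun :=
  TestFunction.hasCompactSupport' φ

theorem tsupport_subset (φ : SmoothCompact Ω) : tsupport φ.toFun ⊆ Ω :=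
  TestFunction.tsupport_subset' φ

theorem eq_zero_of_notMem (φ : SmoothCompact Ω) {x : EuclideanSpace ℝ (Fin N)} (hx : x ∉ Ω) :
    φ.toFun x = 0 :=
  image_eq_zero_of_notMem_tsupport fun h => hx (φ.tsupport_subset h)

theorem support_laplacian_subset (φ : SmoothCompact Ω) :
    Function.support (Δ φ.toFun) ⊆ Ω :=
  (support_laplacian_subset_tsupport _).trans φ.tsupport_subset

theorem continuous_laplacian (φ : SmoothCompact Ω) : Continuous (Δ φ.toFun) := by
  rw [InnerProductSpace.laplacian_eq_iteratedFDeriv_stdOrthonormalBasis]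
  have := φ.contDiff_two.continuous_iteratedFDeriv (m := 2) le_rfl
  fun_prop

theorem hasCompactSupport_laplacian (φ : SmoothCompact Ω) : HasCompactSupport (Δ φ.toFun) :=
  φ.hasCompactSupport.mono' (support_laplacian_subset_tsupport _)

theorem enorm_eq (φ : SmoothCompact Ω) : ‖φ‖ₑ = eLpNorm (Δ φ.toFun) 2 volume := by
  rw [← eLpNorm_restrict_eq_of_support_subset φ.support_laplacian_subset,
    ← Lp.enorm_toLp φ.memLp_laplacian]
  rfl

theorem eLpNorm_hessianNorm_le (φ : SmoothCompact Ω) :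
    eLpNorm (hessianNorm φ.toFun) 2 volume ≤ ‖φ‖ₑ :=
  (eLpNorm_hessianNorm_le_eLpNorm_laplacian φ.contDiff φ.hasCompactSupport).trans_eq
    φ.enorm_eq.symm

theorem memLp (φ : SmoothCompact Ω) (p : ℝ≥0∞) :
    MemLp φ.toFun p (volume.restrict (Ω : Set (EuclideanSpace ℝ (Fin N)))) :=
  (φ.contDiff.continuous.memLp_of_hasCompactSupport φ.hasCompactSupport).restrict _

variable (Ω p) in
/-- The inclusion of `C_c^∞(Ω)` into `L^p(Ω)`. -/
noncomputable def toLp :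
    SmoothCompact Ω →ₗ[ℝ] Lp ℝ p (volume.restrict (Ω : Set (EuclideanSpace ℝ (Fin N)))) where
  toFun φ := (φ.memLp p).toLp _
  map_add' φ ψ := MemLp.toLp_add (φ.memLp p) (ψ.memLp p)
  map_smul' c φ := MemLp.toLp_const_smul c (φ.memLp p)

theorem coeFn_toLp (φ : SmoothCompact Ω) :
    toLp Ω p φ =ᵐ[volume.restrict (Ω : Set (EuclideanSpace ℝ (Fin N)))] φ.toFun :=
  (φ.memLp p).coeFn_toLp

theorem coeFn_laplacianLp (φ : SmoothCompact Ω) :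
    laplacianLp Ω φ =ᵐ[volume.restrict (Ω : Set (EuclideanSpace ℝ (Fin N)))] Δ φ.toFun :=
  φ.memLp_laplacian.coeFn_toLp

theorem setIntegral_laplacian_mul (φ ψ : SmoothCompact Ω) :
    ∫ x in Ω, Δ φ.toFun x * ψ.toFun x = ∫ x in Ω, φ.toFun x * Δ ψ.toFun x := by
  rw [setIntegral_eq_integral_of_forall_compl_eq_zero fun x hx => by
      rw [ψ.eq_zero_of_notMem hx, mul_zero],
    setIntegral_eq_integral_of_forall_compl_eq_zero fun x hx => by
      rw [φ.eq_zero_of_notMem hx, zero_mul],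
    integral_laplacian_mul φ.contDiff φ.hasCompactSupport ψ.contDiff ψ.hasCompactSupport]

theorem exists_lorentzQuasiNorm_le (hN : 5 ≤ N) :
    ∃ C : ℝ≥0, ∀ (Ω : Opens (EuclideanSpace ℝ (Fin N))) (φ : SmoothCompact Ω),
      lorentzQuasiNorm (2 * (N : ℝ) / ((N : ℝ) - 4)) 2 volume φ.toFun ≤ C * ‖φ‖ₑ := by
  refine ⟨Real.toNNReal ((volume (Metric.ball (0 : EuclideanSpace ℝ (Fin N)) 1)).toReal ^
    (-2 / (N : ℝ)) * (N / (N - 4))), fun Ω φ => ?_⟩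
  have hd : 4 < Module.finrank ℝ (EuclideanSpace ℝ (Fin N)) := by
    rw [finrank_euclideanSpace_fin]
    exact hN
  have h := lorentzQuasiNorm_le_mul_eLpNorm_hessianNorm volume hd φ.contDiff_two
    φ.hasCompactSupport
  rw [finrank_euclideanSpace_fin] at h
  exact h.trans (mul_le_mul_right φ.eLpNorm_hessianNorm_le _)

theorem exists_eLpNorm_le (hN : 5 ≤ N) :
    ∃ p C : ℝ≥0, 1 ≤ p ∧ ∀ (Ω : Opens (EuclideanSpace ℝ (Fin N))) (φ : SmoothCompact Ω),
      eLpNorm φ.toFun p volume ≤ C * ‖φ‖ₑ := by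
  have hN' : (5 : ℝ) ≤ N := mod_cast hN
  have hd : Module.finrank ℝ (EuclideanSpace ℝ (Fin N)) = N := finrank_euclideanSpace_fin
  obtain ⟨p, hp⟩ : ∃ p : ℝ≥0, (p : ℝ) = 2 * N / (N - 4) :=
    CanLift.prf _ (div_nonneg (by linarith) (by linarith))
  have hp1 : 1 ≤ p := by
    rw [← NNReal.coe_le_coe, hp, NNReal.coe_one, one_le_div (by linarith)]
    linarith
  obtain ⟨C, hC⟩ := exists_eLpNorm_le_mul_eLpNorm_hessianNorm
    (volume : Measure (EuclideanSpace ℝ (Fin N))) (p := 2) (p' := p) one_le_two (by omega) (by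
      rw [hd, hp, NNReal.coe_ofNat]
      have : (N : ℝ) - 4 ≠ 0 := by linarith
      field_simp
      ring)
  exact ⟨p, C, hp1, fun Ω φ => (hC _ φ.contDiff_two φ.hasCompactSupport).trans
    (mul_le_mul_right φ.eLpNorm_hessianNorm_le _)⟩

end SmoothCompact

theorem exists_continuousLinearMap_eq_integral_mul {X : Type*} [MeasurableSpace X]
    {ν : Measure X} {q : ℝ≥0∞} [Fact (1 ≤ p)] [ENNReal.HolderConjugate p q] {h : X → ℝ}
    (hh : MemLp h q ν) : ∃ ℓ : Lp ℝ p ν →L[ℝ] ℝ, ∀ g : Lp ℝ p ν, ℓ g = ∫ x, g x * h x ∂ν := by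
  have : Fact (1 ≤ q) := ⟨ENNReal.HolderConjugate.one_le q p⟩
  refine ⟨((ContinuousLinearMap.mul ℝ ℝ).lpPairing ν p q).flip (hh.toLp _), fun g => ?_⟩
  rw [ContinuousLinearMap.flip_apply, ContinuousLinearMap.lpPairing_eq_integral]
  refine integral_congr_ae ?_
  filter_upwards [hh.coeFn_toLp] with x hx
  rw [hx, ContinuousLinearMap.mul_apply']

namespace BeppoLevi

theorem exists_seq_tendsto (u : BeppoLevi Ω) :
    ∃ φ : ℕ → SmoothCompact Ω, Tendsto (fun n => (φ n : BeppoLevi Ω)) atTop (𝓝 u) := by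
  obtain ⟨x, hx, hxu⟩ := mem_closure_iff_seq_limit.1
    (UniformSpace.Completion.denseRange_coe (α := SmoothCompact Ω) u)
  choose φ hφ using hx
  exact ⟨φ, by simpa only [hφ] using hxu⟩

theorem exists_extension {F : Type*} [NormedAddCommGroup F] [NormedSpace ℝ F]
    [CompleteSpace F] (T : SmoothCompact Ω →ₗ[ℝ] F) {C : ℝ} (hT : ∀ φ, ‖T φ‖ ≤ C * ‖φ‖) :
    ∃ S : BeppoLevi Ω →L[ℝ] F, ∀ φ : SmoothCompact Ω, S φ = T φ :=
  ⟨(T.mkContinuous C hT).extend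
      (UniformSpace.Completion.toComplL : SmoothCompact Ω →L[ℝ] BeppoLevi Ω),
    fun φ => (T.mkContinuous C hT).extend_eq UniformSpace.Completion.denseRange_coe
      (UniformSpace.Completion.isUniformInducing_coe _) φ⟩

variable [Fact (1 ≤ p)]

theorem exists_toLp_extension {C : ℝ≥0}
    (hC : ∀ φ : SmoothCompact Ω, eLpNorm φ.toFun p volume ≤ C * ‖φ‖ₑ) :
    ∃ S : BeppoLevi Ω →L[ℝ] Lp ℝ p (volume.restrict (Ω : Set (EuclideanSpace ℝ (Fin N)))),
      ∀ φ : SmoothCompact Ω, S φ = SmoothCompact.toLp Ω p φ := by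
  refine exists_extension _ (C := C) fun φ => ?_
  rw [← ENNReal.ofReal_le_ofReal_iff (by positivity), ofReal_norm,
    ENNReal.ofReal_mul C.coe_nonneg, ENNReal.ofReal_coe_nnreal, ofReal_norm]
  exact (Lp.enorm_toLp (φ.memLp p)).trans_le
    ((eLpNorm_mono_measure _ Measure.restrict_le_self).trans (hC φ))

theorem exists_laplacianLp_extension :
    ∃ L : BeppoLevi Ω →L[ℝ] Lp ℝ 2 (volume.restrict (Ω : Set (EuclideanSpace ℝ (Fin N)))),
      (∀ φ : SmoothCompact Ω, L φ = SmoothCompact.laplacianLp Ω φ) ∧ ∀ u, ‖L u‖ = ‖u‖ := by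
  obtain ⟨L, hL⟩ := exists_extension (SmoothCompact.laplacianLp Ω) (C := 1)
    fun φ => (one_mul ‖φ‖).ge
  refine ⟨L, hL, fun u => ?_⟩
  induction u using UniformSpace.Completion.induction_on with
  | hp => exact isClosed_eq L.continuous.norm continuous_norm
  | ih φ =>
    rw [hL, UniformSpace.Completion.norm_coe]
    rfl

variable {S : BeppoLevi Ω →L[ℝ] Lp ℝ p (volume.restrict (Ω : Set (EuclideanSpace ℝ (Fin N))))}
  (hS : ∀ φ : SmoothCompact Ω, S φ = SmoothCompact.toLp Ω p φ)

include hS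

theorem coeFn_extension (φ : SmoothCompact Ω) :
    S φ =ᵐ[volume.restrict (Ω : Set (EuclideanSpace ℝ (Fin N)))] φ.toFun :=
  hS φ ▸ φ.coeFn_toLp

theorem integral_mul_eq_integral_mul_laplacian
    {L : BeppoLevi Ω →L[ℝ] Lp ℝ 2 (volume.restrict (Ω : Set (EuclideanSpace ℝ (Fin N))))}
    (hL : ∀ φ : SmoothCompact Ω, L φ = SmoothCompact.laplacianLp Ω φ)
    (u : BeppoLevi Ω) (ψ : SmoothCompact Ω) :
    ∫ x in Ω, L u x * ψ.toFun x = ∫ x in Ω, S u x * Δ ψ.toFun x := by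
  obtain ⟨ℓ₁, h₁⟩ := exists_continuousLinearMap_eq_integral_mul (p := 2) (ψ.memLp 2)
  obtain ⟨ℓ₂, h₂⟩ := exists_continuousLinearMap_eq_integral_mul (p := p)
    (q := ENNReal.conjExponent p) ((ψ.continuous_laplacian.memLp_of_hasCompactSupport
      ψ.hasCompactSupport_laplacian (μ := volume)).restrict Ω)
  rw [← h₁, ← h₂]
  induction u using UniformSpace.Completion.induction_on with
  | hp => exact isClosed_eq (ℓ₁.continuous.comp L.continuous) (ℓ₂.continuous.comp S.continuous)
  | ih φ =>
    rw [h₁, h₂, hL, hS]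
    calc
      _ = ∫ x in Ω, Δ φ.toFun x * ψ.toFun x := integral_congr_ae (φ.coeFn_laplacianLp.mul .rfl)
      _ = ∫ x in Ω, φ.toFun x * Δ ψ.toFun x := φ.setIntegral_laplacian_mul ψ
      _ = _ := integral_congr_ae (φ.coeFn_toLp.symm.mul .rfl)

theorem injective_extension : Function.Injective S := by
  obtain ⟨L, hL, hLnorm⟩ := exists_laplacianLp_extension (Ω := Ω)
  refine (injective_iff_map_eq_zero S).2 fun u hu => ?_
  rw [← norm_eq_zero, ← hLnorm, norm_eq_zero, Lp.eq_zero_iff_ae_eq_zero, EventuallyEq,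
    ae_restrict_iff' Ω.isOpen.measurableSet]
  have hloc : LocallyIntegrableOn (L u) (Ω : Set (EuclideanSpace ℝ (Fin N))) :=
    locallyIntegrableOn_of_locallyIntegrable_restrict
      ((Lp.memLp (L u)).locallyIntegrable one_le_two)
  refine Ω.isOpen.ae_eq_zero_of_integral_contDiff_smul_eq_zero hloc fun g hg hgc hgs => ?_
  let ψ : SmoothCompact Ω := (⟨g, hg, hgc, hgs⟩ : 𝓓(Ω, ℝ))
  calc
    ∫ x, g x • L u x = ∫ x in Ω, L u x * ψ.toFun x := by
      rw [setIntegral_eq_integral_of_forall_compl_eq_zero fun x hx => by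
        rw [ψ.eq_zero_of_notMem hx, mul_zero]]
      exact integral_congr_ae (.of_forall fun x => mul_comm _ _)
    _ = ∫ x in Ω, S u x * Δ ψ.toFun x := integral_mul_eq_integral_mul_laplacian hS hL u ψ
    _ = 0 := by
      rw [hu]
      refine integral_eq_zero_of_ae ?_
      filter_upwards [Lp.coeFn_zero ℝ p _] with x hx
      rw [hx, Pi.zero_apply, zero_mul]

theorem exists_seq_tendsto_ae (u : BeppoLevi Ω) :
    ∃ φ : ℕ → SmoothCompact Ω, Tendsto (fun n => ‖φ n‖ₑ) atTop (𝓝 ‖u‖ₑ) ∧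
      ∀ᵐ x ∂volume.restrict (Ω : Set (EuclideanSpace ℝ (Fin N))),
        Tendsto (fun n => (φ n).toFun x) atTop (𝓝 (S u x)) := by
  obtain ⟨φ, hφ⟩ := exists_seq_tendsto u
  have hSφ : Tendsto (fun n => S (φ n)) atTop (𝓝 (S u)) := (S.continuous.tendsto u).comp hφ
  obtain ⟨k, hk, hlim⟩ := (tendstoInMeasure_of_tendsto_Lp hSφ).exists_seq_tendsto_ae
  refine ⟨fun n => φ (k n), ?_, ?_⟩
  · refine ((continuous_enorm.tendsto u).comp (hφ.comp hk.tendsto_atTop)).congr fun n => ?_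
    exact UniformSpace.Completion.enorm_coe _
  · filter_upwards [hlim, ae_all_iff.2 fun n => coeFn_extension hS (φ (k n))] with x hx hcoe
    simpa only [hcoe] using hx

theorem lorentzQuasiNorm_extension_le {r : ℝ} {q : ℝ≥0∞} (hq : q ≠ 0) (hq' : q ≠ ∞) {C : ℝ≥0}
    (hC : ∀ φ : SmoothCompact Ω, lorentzQuasiNorm r q volume φ.toFun ≤ C * ‖φ‖ₑ)
    (u : BeppoLevi Ω) :
    lorentzQuasiNorm r q (volume.restrict (Ω : Set (EuclideanSpace ℝ (Fin N)))) (S u)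
      ≤ C * ‖u‖ₑ := by
  obtain ⟨φ, hφ, hlim⟩ := exists_seq_tendsto_ae hS u
  calc
    _ ≤ liminf (fun n => lorentzQuasiNorm r q
          (volume.restrict (Ω : Set (EuclideanSpace ℝ (Fin N)))) (φ n).toFun) atTop :=
      lorentzQuasiNorm_le_liminf hq hq' hlim
    _ ≤ liminf (fun n => C * ‖φ n‖ₑ) atTop :=
      liminf_le_liminf (.of_forall fun n =>
        (lorentzQuasiNorm_mono_measure r q Measure.restrict_le_self _).trans (hC (φ n)))
    _ = C * ‖u‖ₑ := (ENNReal.Tendsto.const_mul hφ (.inr ENNReal.coe_ne_top)).liminf_eq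

end BeppoLevi

end Embedding

theorem mainTheorem5 (N : ℕ) (hN : 5 ≤ N) :
    ∃ C : ℝ≥0, ∀ Ω : TopologicalSpace.Opens (EuclideanSpace ℝ (Fin N)),
      ∃ J : BeppoLevi Ω →ₗ[ℝ]
          (EuclideanSpace ℝ (Fin N) →ₘ[volume.restrict (Ω : Set (EuclideanSpace ℝ (Fin N)))] ℝ),
        (∀ φ : SmoothCompact Ω,
          ⇑(J (φ : BeppoLevi Ω))
            =ᵐ[volume.restrict (Ω : Set (EuclideanSpace ℝ (Fin N)))] φ.toFun) ∧
        Function.Injective J ∧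
        (∀ u : BeppoLevi Ω,
          J u ∈ lorentzSpace (2 * (N : ℝ) / ((N : ℝ) - 4)) 2
            (volume.restrict (Ω : Set (EuclideanSpace ℝ (Fin N))))) ∧
        (∀ u : BeppoLevi Ω,
          lorentzQuasiNorm (2 * (N : ℝ) / ((N : ℝ) - 4)) 2
            (volume.restrict (Ω : Set (EuclideanSpace ℝ (Fin N)))) (J u) ≤ C * ‖u‖ₑ) ∧
        (∀ u : BeppoLevi Ω,
          lorentzNorm (2 * (N : ℝ) / ((N : ℝ) - 4)) 2
            (volume.restrict (Ω : Set (EuclideanSpace ℝ (Fin N)))) (J u) ≤ C * ‖u‖ₑ) := by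
  obtain ⟨c, hc⟩ := SmoothCompact.exists_lorentzQuasiNorm_le hN
  obtain ⟨p, C₀, hp, hC₀⟩ := SmoothCompact.exists_eLpNorm_le hN
  have : Fact (1 ≤ (p : ℝ≥0∞)) := ⟨mod_cast hp⟩
  set r : ℝ := 2 * N / (N - 4)
  have hr : 1 < r := by
    have hN' : (5 : ℝ) ≤ N := mod_cast hN
    rw [one_lt_div (by linarith)]
    linarith
  refine ⟨(r / (r - 1)).toNNReal * c, fun Ω => ?_⟩
  obtain ⟨S, hS⟩ := BeppoLevi.exists_toLp_extension (hC₀ Ω)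
  have hnorm (u : BeppoLevi Ω) : lorentzNorm r 2 (volume.restrict Ω) (S u) ≤
      ↑((r / (r - 1)).toNNReal * c) * ‖u‖ₑ := by
    rw [ENNReal.coe_mul, mul_assoc]
    exact (lorentzNorm_two_le_lorentzQuasiNorm hr _ _).trans (mul_le_mul_right
      (BeppoLevi.lorentzQuasiNorm_extension_le hS two_ne_zero ENNReal.ofNat_ne_top (hc Ω) u) _)
  have hquasi u := (lorentzQuasiNorm_le_lorentzNorm r 2 _ (S u)).trans (hnorm u)
  let J : BeppoLevi Ω →ₗ[ℝ] (EuclideanSpace ℝ (Fin N) →ₘ[volume.restrict Ω] ℝ) :=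
    { toFun u := (S u).1
      map_add' u v := congrArg Subtype.val (S.map_add u v)
      map_smul' a u := congrArg Subtype.val (S.map_smul a u) }
  exact ⟨J, BeppoLevi.coeFn_extension hS,
    Subtype.val_injective.comp (BeppoLevi.injective_extension hS),
    fun u => (hquasi u).trans_lt (ENNReal.mul_lt_top ENNReal.coe_lt_top enorm_lt_top),
    hquasi, hnorm⟩
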